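/- Let $H$ be a real Hilbert space and $A:D(A)\subset H\to H$ a self-adjoint positive operator with an orthonormal eigenbasis $Ae_k=\lambda_ke_k$, $0<\lambda_1\le\lambda_2\le\dots$, $\lambda_k\to\infty$. For $s\in\mathbb R$ let $F_s=D(A^s)$ be the Hilbert space of formal series $\sum_k c_ke_k$ with $\|\cdot\|_s^2=\sum_k\lambda_k^{2s}c_k^2<\infty$. Let $\beta,\nu>0$, $\omega\ge0$, $p\in H$; let $\mu_1,\mu_2\in C^1(0,\infty)\cap L^1(0,\infty)\cap C[0,\infty)$ satisfy $\mu_i\ge0$ and $\mu_i'+\delta_i\mu_i\le0$ with $\delta_i>0$; let $M\in C[0,\infty)\cap C^2(0,\infty)$ satisfy $\int_0^zM(\xi)\,d\xi\ge-az-b$ for all $z\ge0$, for some $a\in(0,\lambda_1)$ and $b\in\mathbb R$. On $$\mathcal H=F_1\times F_0\times F_0\times L^2_{\mu_1}(\mathbb R_+;F_1)\times L^2_{\mu_2}(\mathbb R_+;F_{1/2})$$ consider, for $U=(u;w;v;\bar\eta;\eta)$, the operator $$\mathcal LU=\Big(w;\;-\beta A^2u-\int_0^\infty\mu_1(s)A^2\bar\eta(s)\,ds+\nu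 Av;\;-\omega Av-\int_0^\infty\mu_2(s)A\eta(s)\,ds-\nu Aw;\;-\bar\eta_s+w;\;-\eta_s+v\Big),$$ where $\bar\eta_s,\eta_s$ are distributional derivatives. Its domain $D(\mathcal L)$ consists of the $U\in\mathcal H$ such that $\bar\eta_s\in L^2_{\mu_1}(\mathbb R_+;F_1)$, $\eta_s\in L^2_{\mu_2}(\mathbb R_+;F_{1/2})$, $\bar\eta(0)=\eta(0)=0$, $w\in F_1$, $v\in F_{1/2}$, $\beta A^2u+\int_0^\infty\mu_1A^2\bar\eta\,ds-\nu Av\in F_0$ and $\omega Av+\int_0^\infty\mu_2A\eta\,ds\in F_0$. Let $f(U)=(0;\,-M(\|A^{1/2}u\|^2)Au+p;\,0;\,0;\,0)$. A classical solution on $[0,\infty)$ with initial value $U_0$ is a function $U\in C^1([0,\infty);\mathcal H)$ with $U(0)=U_0$, $U(t)\in D(\mathcal L)$ and $\dot U(t)=\mathcal LU(t)+f(U(t))$ for all $t\ge0$. Let $U_0=(u_0;w_0;v_0;\bar\eta_0;\eta_0)\in D(\mathcal L)$ and suppose that the initial past history $u_0(s)=u_0-\bar\eta_0(s)$, $s>0$,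 belongs to $L^\infty(0,\infty;F_{3/2})$ (for some representative of $\bar\eta_0$). Let $U=(u;w;v;\bar\eta;\eta)$ be a classical solution with $U(0)=U_0$. Then $$u\in C([0,\infty);F_{3/2}).$$ Suppose moreover that $H=L^2(\Omega)$ and $A=-\Delta$ with $D(A)=H^2(\Omega)\cap H^1_0(\Omega)$, where $\Omega\subset\mathbb R^2$ is a bounded domain for which this operator satisfies the assumptions above (for instance one with smooth or rectangular boundary). Then for every $t\ge0$ the function $u(t)$ lies in $H^2(\Omega)$ and $\Delta u(t)=0$ on $\partial\Omega$ in the sense of traces, i.e. $\Delta u(t)\in H^1_0(\Omega)$. -/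

import Mathlib

open Set Filter Topology MeasureTheory
open scoped InnerProductSpace

noncomputable section

namespace Berger

/-! ### The operator `A` and the scale of spaces `F_s` -/

/-- A self-adjoint positive operator `A : D(A) ⊆ H → H` together with an orthonormal eigenbasis
`A e_k = λ_k e_k`, `0 < λ_0 ≤ λ_1 ≤ …`, `λ_k → ∞` (the numbering starts at `0`). -/
structure SpectralOperator (H : Type*) [NormedAddCommGroup H] [InnerProductSpace ℝ H]
    [CompleteSpace H] where
  A : H →ₗ.[ℝ] H
  selfAdjoint : IsSelfAdjoint A
  positive : ∀ x : A.domain, (x : H) ≠ 0 → 0 < ⟪A x, (x : H)⟫_ℝ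
  e : HilbertBasis ℕ ℝ H
  lam : ℕ → ℝ
  e_mem : ∀ k, e k ∈ A.domain
  A_e : ∀ k, A ⟨e k, e_mem k⟩ = lam k • e k
  lam_pos : ∀ k, 0 < lam k
  lam_mono : Monotone lam
  lam_tendsto : Tendsto lam atTop atTop

variable {H : Type*} [NormedAddCommGroup H] [InnerProductSpace ℝ H] [CompleteSpace H]

namespace SpectralOperator

/-- The formal series `∑ c_k e_k` (given by its coefficients) belongs to `F_s`, i.e.
`∑ λ_k^{2s} c_k² < ∞`. -/
def Mem (S : SpectralOperator H) (s : ℝ) (c : ℕ → ℝ) : Prop :=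
  Summable fun k => S.lam k ^ (2 * s) * c k ^ 2

/-- The power `A^r` acting on formal series: `∑ c_k e_k ↦ ∑ λ_k^r c_k e_k`. -/
def pow (S : SpectralOperator H) (r : ℝ) (c : ℕ → ℝ) : ℕ → ℝ := fun k => S.lam k ^ r * c k

theorem mem_iff_memℓp (S : SpectralOperator H) (s : ℝ) (c : ℕ → ℝ) :
    S.Mem s c ↔ Memℓp (S.pow s c) 2 := by
  rw [memℓp_gen_iff (by norm_num)]
  refine summable_congr fun k => ?_
  have h := (S.lam_pos k).le
  simp only [pow, ENNReal.toReal_ofNat, Real.rpow_two, Real.norm_eq_abs, sq_abs, mul_pow]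
  rw [mul_comm 2 s, Real.rpow_mul h, Real.rpow_two]

/-- `F_s` as a space of formal series. -/
def scale (S : SpectralOperator H) (s : ℝ) : Submodule ℝ (ℕ → ℝ) where
  carrier := {c | S.Mem s c}
  zero_mem' := by simp [Mem, summable_zero]
  add_mem' := by
    intro a b ha hb
    rw [Set.mem_ofPred_eq, mem_iff_memℓp] at *
    convert ha.add hb using 1
    funext k
    simp [pow, mul_add]
  smul_mem' := by
    intro r a ha
    rw [Set.mem_ofPred_eq, mem_iff_memℓp] at *
    convert ha.const_smul r using 1
    funext k
    simp [pow, mul_left_comm]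

/-- The space `F_s = D(A^s)`, `s ∈ ℝ`, of formal series `∑ c_k e_k` with
`∑ λ_k^{2s} c_k² < ∞`. -/
def F (S : SpectralOperator H) (s : ℝ) : Type := ↥(S.scale s)

variable (S : SpectralOperator H) {r s t : ℝ}

instance : AddCommGroup (S.F s) := inferInstanceAs (AddCommGroup ↥(S.scale s))
instance : Module ℝ (S.F s) := inferInstanceAs (Module ℝ ↥(S.scale s))

variable {S}

/-- The coefficients of an element of `F_s`. -/
def F.coeff (x : S.F s) : ℕ → ℝ := x.1

variable (S)

/-- `A^s` identifies `F_s` with `ℓ²`. -/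
def toEll (s : ℝ) : S.F s ≃ₗ[ℝ] lp (fun _ : ℕ => ℝ) 2 where
  toFun x := ⟨S.pow s x.coeff, (S.mem_iff_memℓp s _).1 x.2⟩
  map_add' x y := by
    ext k
    exact mul_add (S.lam k ^ s) (x.1 k) (y.1 k)
  map_smul' c x := by
    ext k
    exact mul_left_comm (S.lam k ^ s) c (x.1 k)
  invFun y := ⟨S.pow (-s) y, by
    have h : S.pow s (S.pow (-s) y) = y := by
      funext k
      have := S.lam_pos k
      simp only [pow, ← mul_assoc, ← Real.rpow_add this]
      simp
    change S.Mem s _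
    rw [mem_iff_memℓp, h]
    exact y.2⟩
  left_inv x := by
    apply Subtype.ext
    funext k
    have := S.lam_pos k
    change S.lam k ^ (-s) * (S.lam k ^ s * x.1 k) = x.1 k
    rw [← mul_assoc, ← Real.rpow_add this]
    simp
  right_inv y := by
    ext k
    have := S.lam_pos k
    change S.lam k ^ s * (S.lam k ^ (-s) * y k) = y k
    rw [← mul_assoc, ← Real.rpow_add this]
    simp

instance : NormedAddCommGroup (S.F s) :=
  NormedAddCommGroup.induced _ _ (S.toEll s) (S.toEll s).injective

/-- The inner product `(v, w)_s = (A^s v, A^s w)`. -/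
instance : InnerProductSpace ℝ (S.F s) where
  __ := NormedSpace.induced ℝ (S.F s) _ (S.toEll s)
  inner x y := ⟪S.toEll s x, S.toEll s y⟫_ℝ
  norm_sq_eq_re_inner x := norm_sq_eq_re_inner (𝕜 := ℝ) (S.toEll s x)
  conj_inner_symm x y := inner_conj_symm (𝕜 := ℝ) (S.toEll s x) (S.toEll s y)
  add_left x y z := by simp only [map_add, inner_add_left]
  smul_left x y c := by
    simp only [map_smul]
    exact inner_smul_left _ _ _

theorem inner_eq_tsum (x y : S.F s) :
    ⟪x, y⟫_ℝ = ∑' k, S.lam k ^ (2 * s) * (x.coeff k * y.coeff k) := by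
  change ⟪S.toEll s x, S.toEll s y⟫_ℝ = _
  rw [lp.inner_eq_tsum]
  refine tsum_congr fun k => ?_
  have h := (S.lam_pos k).le
  change (S.lam k ^ s * y.coeff k) * (S.lam k ^ s * x.coeff k) = _
  rw [mul_comm 2 s, Real.rpow_mul h, Real.rpow_two]
  ring

instance : CompleteSpace (S.F s) := by
  have hi : Isometry (S.toEll s) := AddMonoidHomClass.isometry_of_norm _ fun _ => rfl
  exact (hi.isUniformInducing.completeSpace_congr (S.toEll s).surjective).2 inferInstance

/-- `A^r : F_s → F_{s-r}`. -/
def powF (r : ℝ) {s t : ℝ} (x : S.F s) (h : t + r = s := by norm_num) : S.F t :=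
  ⟨S.pow r x.coeff, by
    subst h
    change S.Mem t _
    have hx : S.Mem (t + r) x.coeff := x.2
    rw [mem_iff_memℓp] at *
    convert hx using 1
    funext k
    simp only [pow, ← mul_assoc, ← Real.rpow_add (S.lam_pos k)]⟩

/-- The inclusion `F_s ⊆ F_t`, `t ≤ s`. -/
def incl {s t : ℝ} (x : S.F s) (h : t ≤ s := by norm_num) : S.F t :=
  ⟨x.coeff, by
    change S.Mem t _
    have hx : S.Mem s x.coeff := x.2
    refine Summable.of_nonneg_of_le (fun k => ?_) (fun k => ?_)
      (hx.mul_left (S.lam 0 ^ (2 * (t - s))))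
    · have := S.lam_pos k
      positivity
    · have h0 := S.lam_pos 0
      have hk := S.lam_pos k
      have h1 : S.lam k ^ (2 * (t - s)) ≤ S.lam 0 ^ (2 * (t - s)) :=
        Real.rpow_le_rpow_of_nonpos h0 (S.lam_mono (Nat.zero_le k)) (by linarith)
      have h2 : S.lam k ^ (2 * t) = S.lam k ^ (2 * (t - s)) * S.lam k ^ (2 * s) := by
        rw [← Real.rpow_add hk]
        ring_nf
      rw [h2, mul_assoc]
      exact mul_le_mul_of_nonneg_right h1 (by positivity)⟩

/-- The coefficients `(p, e_k)` of `p ∈ H`. -/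
def coeffH (p : H) : ℕ → ℝ := fun k => ⟪S.e k, p⟫_ℝ

/-- The element `∑ c_k e_k` of `H` represented by an element of `F_s`, `s ≥ 0`. -/
def toH (x : S.F s) : H := ∑' k, x.coeff k • S.e k

end SpectralOperator

/-! ### Memory spaces -/

/-- The measure `μ(s) ds` on `(0, ∞)`; `L²_μ(ℝ₊; X)` is `Lp X 2 (memMeasure μ)`. -/
def memMeasure (μ : ℝ → ℝ) : Measure ℝ :=
  (volume.restrict (Ioi 0)).withDensity fun s => ENNReal.ofReal (μ s)

/-- The standing assumptions on a memory kernel. -/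
structure IsKernel (μ : ℝ → ℝ) (δ : ℝ) : Prop where
  contDiffOn : ContDiffOn ℝ 1 μ (Ioi 0)
  continuousOn : ContinuousOn μ (Ici 0)
  integrableOn : IntegrableOn μ (Ioi 0)
  nonneg : ∀ s, 0 ≤ s → 0 ≤ μ s
  decay_pos : 0 < δ
  decay : ∀ s, 0 < s → deriv μ s + δ * μ s ≤ 0

/-- `ξ ∈ L²_μ(ℝ₊; X)` has the distributional derivative `ξ_s = ζ ∈ L²_μ(ℝ₊; X)`, and `ξ(0) = 0`.
An element of `L²_μ` is determined (almost everywhere) on the set `{μ > 0}` only, so the test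
functions are supported there. -/
structure HasMemoryDeriv {X : Type*} [NormedAddCommGroup X] [NormedSpace ℝ X] (μ : ℝ → ℝ)
    (ξ ζ : Lp X 2 (memMeasure μ)) : Prop where
  weak : ∀ φ : ℝ → ℝ, ContDiff ℝ ((⊤ : ℕ∞) : WithTop ℕ∞) φ → HasCompactSupport φ →
    tsupport φ ⊆ {s | 0 < s ∧ 0 < μ s} →
    ∫ s in Ioi 0, deriv φ s • ξ s = - ∫ s in Ioi 0, φ s • ζ s
  zero : ∃ g : ℝ → X, g =ᵐ[memMeasure μ] ξ ∧ Tendsto g (𝓝[>] 0) (𝓝 0)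

/-! ### The plate system -/

/-- The data of the plate system: the constants `β, ν > 0`, `ω ≥ 0`, the kernels `μ₁, μ₂`, the
nonlinearity `M` and the load `p ∈ H`. -/
structure PlateData (S : SpectralOperator H) where
  β : ℝ
  β_pos : 0 < β
  ν : ℝ
  ν_pos : 0 < ν
  ω : ℝ
  ω_nonneg : 0 ≤ ω
  μ₁ : ℝ → ℝ
  μ₂ : ℝ → ℝ
  δ₁ : ℝ
  δ₂ : ℝ
  kernel₁ : IsKernel μ₁ δ₁
  kernel₂ : IsKernel μ₂ δ₂
  M : ℝ → ℝ
  M_cont : ContinuousOn M (Ici 0)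
  M_contDiff : ContDiffOn ℝ 2 M (Ioi 0)
  a : ℝ
  b : ℝ
  a_mem : a ∈ Ioo 0 (S.lam 0)
  M_lower : ∀ z, 0 ≤ z → - a * z - b ≤ ∫ x in (0 : ℝ)..z, M x
  p : H

namespace PlateData

variable {S : SpectralOperator H} (P : PlateData S)

/-- `F_1 × F_0 × F_0 × L²_{μ₁}(ℝ₊; F_1) × L²_{μ₂}(ℝ₊; F_{1/2})`. The product carries the maximum
norm, which is equivalent to the Hilbert norm. -/
abbrev Phase : Type :=
  S.F 1 × S.F 0 × S.F 0 × Lp (S.F 1) 2 (memMeasure P.μ₁) × Lp (S.F (1 / 2)) 2 (memMeasure P.μ₂)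

variable {P}

/-- The component `u` of `U = (u; w; v; η̄; η)`. -/
def u (U : P.Phase) : S.F 1 := U.1
/-- The component `w` of `U = (u; w; v; η̄; η)`. -/
def w (U : P.Phase) : S.F 0 := U.2.1
/-- The component `v` of `U = (u; w; v; η̄; η)`. -/
def v (U : P.Phase) : S.F 0 := U.2.2.1
/-- The component `η̄` of `U = (u; w; v; η̄; η)`. -/
def etaBar (U : P.Phase) : Lp (S.F 1) 2 (memMeasure P.μ₁) := U.2.2.2.1
/-- The component `η` of `U = (u; w; v; η̄; η)`. -/
def eta (U : P.Phase) : Lp (S.F (1 / 2)) 2 (memMeasure P.μ₂) := U.2.2.2.2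

variable (P)

/-- `∫₀^∞ μ₁(s) A² η̄(s) ds`, a Bochner integral in `F_{-1}`. -/
def memoryBar (U : P.Phase) : S.F (-1) :=
  ∫ s, (S.powF 2 (etaBar U s) : S.F (-1)) ∂memMeasure P.μ₁

/-- `∫₀^∞ μ₂(s) A η(s) ds`, a Bochner integral in `F_{-1/2}`. -/
def memory (U : P.Phase) : S.F (-1 / 2) :=
  ∫ s, (S.powF 1 (eta U s) : S.F (-1 / 2)) ∂memMeasure P.μ₂

/-- `β A² u + ∫₀^∞ μ₁(s) A² η̄(s) ds - ν A v` -/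
def elasticPart (U : P.Phase) : ℕ → ℝ :=
  P.β • S.pow 2 (u U).coeff + (P.memoryBar U).coeff - P.ν • S.pow 1 (v U).coeff

/-- `ω A v + ∫₀^∞ μ₂(s) A η(s) ds` -/
def thermalPart (U : P.Phase) : ℕ → ℝ :=
  P.ω • S.pow 1 (v U).coeff + (P.memory U).coeff

/-- The domain `D(𝓛)`. -/
structure InDomain (U : P.Phase) : Prop where
  etaBar_mem : ∃ ζ, HasMemoryDeriv P.μ₁ (etaBar U) ζ
  eta_mem : ∃ ζ, HasMemoryDeriv P.μ₂ (eta U) ζ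
  w_mem : S.Mem 1 (w U).coeff
  v_mem : S.Mem (1 / 2) (v U).coeff
  elastic_mem : S.Mem 0 (P.elasticPart U)
  thermal_mem : S.Mem 0 (P.thermalPart U)

/-- `U ∈ D(𝓛)` and `V = 𝓛 U`. -/
structure IsL (U V : P.Phase) : Prop where
  dom : P.InDomain U
  u_eq : (u V).coeff = (w U).coeff
  w_eq : (w V).coeff = - P.elasticPart U
  v_eq : (v V).coeff = - P.thermalPart U - P.ν • S.pow 1 (w U).coeff
  etaBar_eq : ∃ ζ, HasMemoryDeriv P.μ₁ (etaBar U) ζ ∧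
    ∀ᵐ s ∂memMeasure P.μ₁, (etaBar V s).coeff = - (ζ s).coeff + (w U).coeff
  eta_eq : ∃ ζ, HasMemoryDeriv P.μ₂ (eta U) ζ ∧
    ∀ᵐ s ∂memMeasure P.μ₂, (eta V s).coeff = - (ζ s).coeff + (v U).coeff

/-- `N = f(U)`, where `f(U) = (0; -M(‖A^{1/2}u‖²) A u + p; 0; 0; 0)`. -/
structure IsForce (U N : P.Phase) : Prop where
  u_eq : u N = 0
  w_eq : (w N).coeff = - P.M (‖(S.incl (S.powF (1 / 2) (u U) : S.F (1 / 2)) : S.F 0)‖ ^ 2) •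
    S.pow 1 (u U).coeff + S.coeffH P.p
  v_eq : v N = 0
  etaBar_eq : etaBar N = 0
  eta_eq : eta N = 0

/-- `U` is a classical solution on `[0, ∞)` of `U' = 𝓛 U + f(U)`, `U(0) = U₀`: it is continuously
differentiable on `[0, ∞)` (one-sidedly at `0`), takes values in `D(𝓛)` and satisfies the equation
for all `t ≥ 0`. -/
structure IsClassicalSolution (U₀ : P.Phase) (U : ℝ → P.Phase) : Prop where
  contDiffOn : ContDiffOn ℝ 1 U (Ici 0)
  init : U 0 = U₀
  equation : ∀ t, 0 ≤ t → ∃ V N, P.IsL (U t) V ∧ P.IsForce (U t) N ∧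
    HasDerivWithinAt U (V + N) (Ici 0) t

/-- The past history `u₀(s) = u₀ - η̄₀(s)`, `s > 0`, lies in `L^∞(0, ∞; F_{3/2})`, i.e. the class
`η̄₀` has a representative for which it does. -/
def BoundedPastHistory (U₀ : P.Phase) : Prop :=
  ∃ h : ℝ → S.F (3 / 2), MemLp h ⊤ (volume.restrict (Ioi 0)) ∧
    ∀ᵐ s ∂memMeasure P.μ₁, (h s).coeff = (u U₀ - etaBar U₀ s).coeff

/-- `u ∈ C([0, ∞); F_{3/2})` -/
def DisplacementContinuous (U : ℝ → P.Phase) : Prop :=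
  ∃ g : ℝ → S.F (3 / 2), ContinuousOn g (Ici 0) ∧
    ∀ t, 0 ≤ t → (S.incl (g t) : S.F 1) = u (U t)

end PlateData

/-! ### The Laplacian on `H²(Ω) ∩ H¹₀(Ω)` -/

/-- `ℝ²` -/
abbrev E2 : Type := EuclideanSpace ℝ (Fin 2)

/-- Real-valued `L²(Ω)`. -/
abbrev L2 (Ω : Set E2) : Type := Lp ℝ 2 (volume.restrict Ω)

/-- `∂_i φ` -/
def partialDeriv (i : Fin 2) (φ : E2 → ℝ) (x : E2) : ℝ := fderiv ℝ φ x (EuclideanSpace.single i 1)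

/-- `φ ∈ C_c^∞(Ω)` -/
structure IsTest (Ω : Set E2) (φ : E2 → ℝ) : Prop where
  smooth : ContDiff ℝ ((⊤ : ℕ∞) : WithTop ℕ∞) φ
  compact : HasCompactSupport φ
  supp : tsupport φ ⊆ Ω

/-- `g = ∂_i f` weakly in `Ω`. -/
def IsWeakPartial (Ω : Set E2) (i : Fin 2) (f g : L2 Ω) : Prop :=
  ∀ φ, IsTest Ω φ → ∫ x in Ω, f x * partialDeriv i φ x = - ∫ x in Ω, g x * φ x

/-- `f ∈ H²(Ω)` and `g = Δ f`: all weak derivatives of `f` up to order two lie in `L²(Ω)`, and `g`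
is the sum of the two pure second ones. -/
def HasLaplacian (Ω : Set E2) (f g : L2 Ω) : Prop :=
  ∃ (G : Fin 2 → L2 Ω) (D : Fin 2 → Fin 2 → L2 Ω), (∀ i, IsWeakPartial Ω i f (G i)) ∧
    (∀ i j, IsWeakPartial Ω j (G i) (D i j)) ∧ g = ∑ i, D i i

/-- `f ∈ H¹₀(Ω)`, the closure of `C_c^∞(Ω)` in `H¹(Ω)`. -/
def MemH10 (Ω : Set E2) (f : L2 Ω) : Prop :=
  ∃ G : Fin 2 → L2 Ω, (∀ i, IsWeakPartial Ω i f (G i)) ∧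
    ∀ ε : ENNReal, 0 < ε → ∃ φ, IsTest Ω φ ∧
      eLpNorm (fun x => f x - φ x) 2 (volume.restrict Ω) < ε ∧
      ∀ i, eLpNorm (fun x => G i x - partialDeriv i φ x) 2 (volume.restrict Ω) < ε

/-- `A = -Δ` with `D(A) = H²(Ω) ∩ H¹₀(Ω)`, as an equality of graphs in `L²(Ω) × L²(Ω)`. -/
def IsDirichletLaplacian (Ω : Set E2) (A : L2 Ω →ₗ.[ℝ] L2 Ω) : Prop :=
  ∀ f g : L2 Ω, (f, g) ∈ A.graph ↔ MemH10 Ω f ∧ HasLaplacian Ω f (-g)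

end Berger

end

/-! The elastic equation is read as a Volterra equation for `u` whose forcing is more regular than
`u` itself. Since `w'` and `f(U)` are continuous in time with values in `F_0`, so is G = β A² u + ∫
μ₁ A² η̄ ds - ν A v (`exists_elastic`). The memory component solves the transport equation η̄' =
-η̄_s + u' with η̄(0) = 0, so integration along characteristics (`transport_formula`) gives η̄(t, s)
= u(t) - u(t - s) for s ≤ t and η̄(t, s) = u(t) - h(s - t) for s > t, where h is the past history.
Applying A⁻² (`volterra_coeff`),

(β + ∫ μ₁) u(t) = ∫₀ᵗ μ₁(s) u(t - s) ds + ∫₀^∞ μ₁(s + t) h(s) ds + A⁻² G(t) + ν A⁻¹ v(t).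

As β > 0, the mass of the kernel is smaller than the factor on the left, and the equation is solved
by contraction in any `F_s` containing the forcing; uniqueness for each coefficient identifies that
solution with `u` (`exists_continuousOn_of_volterra`). The history term lies in C([0, ∞); F_{3/2})
because h is bounded there, and A⁻² G even takes values in `F_2`. What remains is v ∈ C([0, ∞);
F_{1/2}), or a substitute.

If μ₂ is positive somewhere, testing η' = -η_s + v with a bump function of s expresses `v` through η
and η', which are continuous in L²_{μ₂}(F_{1/2}). If μ₂ = 0 and ω > 0, the thermal equation gives ω
v = -A⁻¹ v' - ν u', and u' is continuous in `F_1`. If both vanish, v + ν A u is constant in time;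
eliminating `v` adds ν² to the factor on the left and leaves data at time 0 as forcing.

For A = -Δ, u(t) ∈ F_{3/2} means Δu(t) = -A u(t) ∈ F_{1/2}. By Green's formula the fields λ_k^{-1/2}
∇e_k are orthonormal, so a series in `F_{1/2}` converges together with its gradients, and its sum
stays in the closed space H¹₀(Ω). -/

namespace Berger

/-! ### Memory kernels and the spaces `L²_μ` -/

namespace IsKernel

variable {μ : ℝ → ℝ} {δ : ℝ}

theorem antitoneOn (hμ : IsKernel μ δ) : AntitoneOn μ (Ici 0) := by
  refine antitoneOn_of_deriv_nonpos (convex_Ici 0) hμ.continuousOn ?_ ?_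
  · rw [interior_Ici]
    exact hμ.contDiffOn.differentiableOn one_ne_zero
  · rw [interior_Ici]
    intro s hs
    have h1 := hμ.decay s hs
    have h2 := mul_nonneg hμ.decay_pos.le (hμ.nonneg s (le_of_lt hs))
    linarith

theorem pos_of_le (hμ : IsKernel μ δ) {s t : ℝ} (hs : 0 ≤ s) (hst : s ≤ t) (ht : 0 < μ t) :
    0 < μ s :=
  ht.trans_le (hμ.antitoneOn hs (hs.trans hst) hst)

theorem aemeasurable (hμ : IsKernel μ δ) : AEMeasurable μ (volume.restrict (Ioi 0)) :=
  (hμ.continuousOn.mono Ioi_subset_Ici_self).aemeasurable measurableSet_Ioi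

theorem ae_memMeasure_iff (hμ : IsKernel μ δ) {p : ℝ → Prop} :
    (∀ᵐ s ∂memMeasure μ, p s) ↔ ∀ᵐ s : ℝ, 0 < s → 0 < μ s → p s := by
  rw [memMeasure, ae_withDensity_iff' hμ.aemeasurable.ennreal_ofReal,
    ae_restrict_iff' measurableSet_Ioi]
  simp

theorem isOpen_support (hμ : IsKernel μ δ) : IsOpen {s | 0 < s ∧ 0 < μ s} := by
  have := (hμ.continuousOn.mono Ioi_subset_Ici_self).isOpen_inter_preimage isOpen_Ioi
    (isOpen_Ioi (a := (0 : ℝ)))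
  exact this

theorem ae_Ioc_of_ae_memMeasure (hμ : IsKernel μ δ) {p : ℝ → Prop} {r : ℝ} (hr : 0 < μ r)
    (h : ∀ᵐ s ∂memMeasure μ, p s) : ∀ᵐ s ∂volume.restrict (Ioc 0 r), p s := by
  rw [ae_restrict_iff' measurableSet_Ioc]
  filter_upwards [hμ.ae_memMeasure_iff.1 h] with s hs h1
  exact hs h1.1 (hμ.pos_of_le h1.1.le h1.2 hr)

/-- A nonincreasing μ is at least μ(r) on (0, r], so Lebesgue measure there is dominated by a
multiple of the weighted one. This permits unweighted integrals over (0, r] of elements of L²_μ,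
which carry no information where μ vanishes. -/
theorem restrict_Ioc_le (hμ : IsKernel μ δ) {r : ℝ} (hr : 0 < μ r) :
    volume.restrict (Ioc 0 r) ≤ ENNReal.ofReal (μ r)⁻¹ • memMeasure μ := by
  have h1 : ENNReal.ofReal (μ r) • volume.restrict (Ioc 0 r) ≤ memMeasure μ := by
    rw [← withDensity_const, memMeasure, ← withDensity_indicator measurableSet_Ioi,
      ← withDensity_indicator measurableSet_Ioc]
    refine withDensity_mono (Eventually.of_forall fun s => ?_)
    by_cases hs : s ∈ Ioc 0 r
    · have hs' : s ∈ Ioi (0 : ℝ) := hs.1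
      rw [indicator_of_mem hs, indicator_of_mem hs']
      exact ENNReal.ofReal_le_ofReal
        (hμ.antitoneOn (le_of_lt hs.1) (hs.1.le.trans hs.2) hs.2)
    · rw [indicator_of_notMem hs]
      exact zero_le
  have h2 : ENNReal.ofReal (μ r)⁻¹ * ENNReal.ofReal (μ r) = 1 := by
    rw [← ENNReal.ofReal_mul (inv_nonneg.2 hr.le), inv_mul_cancel₀ hr.ne', ENNReal.ofReal_one]
  calc volume.restrict (Ioc 0 r)
      = ENNReal.ofReal (μ r)⁻¹ • ENNReal.ofReal (μ r) • volume.restrict (Ioc 0 r) := by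
        rw [smul_smul, h2, one_smul]
    _ ≤ _ := by gcongr

variable {X : Type*} [NormedAddCommGroup X]

theorem integrableOn_Ioc (hμ : IsKernel μ δ) {r : ℝ} (hr : 0 < μ r) {f : ℝ → X}
    (hf : MemLp f 2 (memMeasure μ)) : IntegrableOn f (Ioc 0 r) :=
  (hf.of_measure_le_smul ENNReal.ofReal_ne_top (hμ.restrict_Ioc_le hr)).integrable
    (by norm_num)

theorem exists_integral_norm_le (hμ : IsKernel μ δ) {r : ℝ} (hr : 0 < μ r) :
    ∃ C, 0 ≤ C ∧ ∀ f : Lp X 2 (memMeasure μ), ∫ s in Ioc 0 r, ‖f s‖ ≤ C * ‖f‖ := by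
  set c : ENNReal := ENNReal.ofReal (μ r)⁻¹
  -- The first factor comes from comparing the two measures, the second from Hölder's inequality on
  -- (0, r].
  set K : ENNReal := c ^ (1 / (2 : ENNReal)).toReal *
    (volume.restrict (Ioc 0 r)) univ ^ (1 / (1 : ENNReal).toReal - 1 / (2 : ENNReal).toReal)
  have hK : K ≠ ⊤ := by
    refine ENNReal.mul_ne_top (ENNReal.rpow_ne_top_of_nonneg (by positivity)
      ENNReal.ofReal_ne_top) (ENNReal.rpow_ne_top_of_nonneg (by norm_num) (by simp))
  refine ⟨K.toReal, ENNReal.toReal_nonneg, fun f => ?_⟩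
  have hint := hμ.integrableOn_Ioc hr (Lp.memLp f)
  have h1 : eLpNorm f 1 (volume.restrict (Ioc 0 r)) ≤ K * eLpNorm f 2 (memMeasure μ) := by
    calc _ ≤ eLpNorm f 2 (volume.restrict (Ioc 0 r)) * (volume.restrict (Ioc 0 r)) univ ^
          (1 / (1 : ENNReal).toReal - 1 / (2 : ENNReal).toReal) :=
          eLpNorm_le_eLpNorm_mul_rpow_measure_univ (by norm_num) hint.aestronglyMeasurable
      _ ≤ eLpNorm f 2 (c • memMeasure μ) * (volume.restrict (Ioc 0 r)) univ ^
          (1 / (1 : ENNReal).toReal - 1 / (2 : ENNReal).toReal) := by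
          gcongr
          exact (hμ.restrict_Ioc_le hr)
      _ = _ := by
          rw [eLpNorm_smul_measure_of_ne_top (by norm_num), smul_eq_mul]
          ring
  rw [integral_norm_eq_lintegral_enorm hint.aestronglyMeasurable, ← eLpNorm_one_eq_lintegral_enorm,
    Lp.norm_def, ← ENNReal.toReal_mul]
  exact ENNReal.toReal_mono (ENNReal.mul_ne_top hK (Lp.eLpNorm_ne_top f)) h1

variable [NormedSpace ℝ X]

theorem integrableOn_smul (hμ : IsKernel μ δ) {r : ℝ} (hr : 0 < μ r) {f : ℝ → X}
    (hf : MemLp f 2 (memMeasure μ)) {φ : ℝ → ℝ} (hφ : Continuous φ) :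
    IntegrableOn (fun s => φ s • f s) (Ioc 0 r) := by
  obtain ⟨C, hC⟩ := isCompact_Icc.exists_bound_of_continuousOn (hφ.continuousOn (s := Icc 0 r))
  refine Integrable.bdd_smul (hμ.integrableOn_Ioc hr hf) C hφ.aestronglyMeasurable ?_
  rw [ae_restrict_iff' measurableSet_Ioc]
  exact Eventually.of_forall fun s hs => hC s ⟨hs.1.le, hs.2⟩

/-- The pairing `(φ, f) ↦ ∫₀ʳ φ f` of bounded continuous functions with `L²_μ`, where
`μ(r) > 0`. -/
theorem exists_pairing (hμ : IsKernel μ δ) {r : ℝ} (hr : 0 < μ r) :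
    ∃ B : BoundedContinuousFunction ℝ ℝ →L[ℝ] Lp X 2 (memMeasure μ) →L[ℝ] X,
      ∀ φ f, B φ f = ∫ s in Ioc 0 r, φ s • f s := by
  obtain ⟨C, hC0, hC⟩ := hμ.exists_integral_norm_le (X := X) hr
  have hi : ∀ (φ : BoundedContinuousFunction ℝ ℝ) (f : Lp X 2 (memMeasure μ)),
      IntegrableOn (fun s => φ s • f s) (Ioc 0 r) := fun φ f =>
    hμ.integrableOn_smul hr (Lp.memLp f) φ.continuous
  let L : BoundedContinuousFunction ℝ ℝ →ₗ[ℝ] Lp X 2 (memMeasure μ) →ₗ[ℝ] X :=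
    LinearMap.mk₂ ℝ (fun φ f => ∫ s in Ioc 0 r, φ s • f s)
      (fun φ ψ f => by
        simp only [BoundedContinuousFunction.coe_add, Pi.add_apply, add_smul]
        exact integral_add (hi φ f) (hi ψ f))
      (fun c φ f => by
        simp only [BoundedContinuousFunction.coe_smul, smul_assoc]
        exact integral_smul _ _)
      (fun φ f g => by
        rw [← integral_add (hi φ f) (hi φ g)]
        refine integral_congr_ae ?_
        filter_upwards [hμ.ae_Ioc_of_ae_memMeasure hr (Lp.coeFn_add f g)] with s hs
        rw [hs, Pi.add_apply, smul_add])
      (fun c φ f => by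
        rw [← integral_smul]
        refine integral_congr_ae ?_
        filter_upwards [hμ.ae_Ioc_of_ae_memMeasure hr (Lp.coeFn_smul c f)] with s hs
        rw [hs, Pi.smul_apply, smul_comm])
  refine ⟨L.mkContinuous₂ C fun φ f => ?_, fun φ f => rfl⟩
  change ‖∫ s in Ioc 0 r, φ s • f s‖ ≤ _
  calc _ ≤ ∫ s in Ioc 0 r, ‖φ‖ * ‖f s‖ := by
        refine norm_integral_le_of_norm_le ((hμ.integrableOn_Ioc hr (Lp.memLp f)).norm.const_mul _)
          (Eventually.of_forall fun s => ?_)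
        rw [norm_smul]
        gcongr
        exact φ.norm_coe_le_norm s
    _ = ‖φ‖ * ∫ s in Ioc 0 r, ‖f s‖ := integral_const_mul _ _
    _ ≤ ‖φ‖ * (C * ‖f‖) := by gcongr; exact hC f
    _ = _ := by ring

end IsKernel

/-! ### Test functions for the memory variable: cut-off at zero and translation -/

theorem deriv_eq_zero_of_forall_le {φ : ℝ → ℝ} {r s : ℝ} (h : ∀ s, r ≤ s → φ s = 0) (hs : r < s) :
    deriv φ s = 0 := by
  have : φ =ᶠ[𝓝 s] fun _ => 0 := by
    filter_upwards [Ioi_mem_nhds hs] with x hx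
    exact h x (le_of_lt hx)
  rw [this.deriv_eq, deriv_const]

theorem setIntegral_Ioi_eq_Ioc {X : Type*} [NormedAddCommGroup X] [NormedSpace ℝ X] {r : ℝ}
    {f : ℝ → X} (h : ∀ s, r < s → f s = 0) : ∫ s in Ioi 0, f s = ∫ s in Ioc 0 r, f s :=
  setIntegral_eq_of_subset_of_forall_sdiff_eq_zero measurableSet_Ioi Ioc_subset_Ioi_self
    fun s hs => h s (not_le.1 fun h' => hs.2 ⟨hs.1, h'⟩)

theorem exists_deriv_smoothTransition_le :
    ∃ C, 0 ≤ C ∧ ∀ x, |deriv Real.smoothTransition x| ≤ C := by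
  have hc : Continuous (deriv Real.smoothTransition) :=
    (Real.smoothTransition.contDiff (n := 1)).continuous_deriv le_rfl
  obtain ⟨C, hC⟩ := isCompact_Icc.exists_bound_of_continuousOn (hc.continuousOn (s := Icc 0 1))
  have hC0 : 0 ≤ C := (norm_nonneg _).trans (hC 0 (by simp))
  refine ⟨C, hC0, fun x => ?_⟩
  by_cases h0 : x < 0
  · have : Real.smoothTransition =ᶠ[𝓝 x] fun _ => 0 := by
      filter_upwards [Iio_mem_nhds h0] with y hy
      exact Real.smoothTransition.zero_of_nonpos (le_of_lt hy)
    rw [this.deriv_eq, deriv_const, abs_zero]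
    exact hC0
  by_cases h1 : 1 < x
  · have : Real.smoothTransition =ᶠ[𝓝 x] fun _ => 1 := by
      filter_upwards [Ioi_mem_nhds h1] with y hy
      exact Real.smoothTransition.one_of_one_le (le_of_lt hy)
    rw [this.deriv_eq, deriv_const, abs_zero]
    exact hC0
  exact hC x ⟨not_lt.1 h0, not_lt.1 h1⟩

theorem deriv_smoothTransition_eq_zero {x : ℝ} (h1 : 1 < x) :
    deriv Real.smoothTransition x = 0 := by
  have : Real.smoothTransition =ᶠ[𝓝 x] fun _ => 1 := by
    filter_upwards [Ioi_mem_nhds h1] with y hy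
    exact Real.smoothTransition.one_of_one_le (le_of_lt hy)
  rw [this.deriv_eq, deriv_const]

variable {X : Type*} [NormedAddCommGroup X] [NormedSpace ℝ X]

/-- Since `ξ(0) = 0`, the weak formulation of `ξ_s = ζ` extends to test functions which do not
vanish near `0`. -/
theorem HasMemoryDeriv.integral_deriv_smul {μ : ℝ → ℝ} {δ : ℝ} (hμ : IsKernel μ δ) {r : ℝ}
    (hr0 : 0 < r) (hr : 0 < μ r) {ξ ζ : Lp X 2 (memMeasure μ)} (h : HasMemoryDeriv μ ξ ζ)
    {φ : ℝ → ℝ} (hφ : ContDiff ℝ ((⊤ : ℕ∞) : WithTop ℕ∞) φ) (hφr : ∀ s, r ≤ s → φ s = 0) :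
    ∫ s in Ioc 0 r, deriv φ s • ξ s = - ∫ s in Ioc 0 r, φ s • ζ s := by
  obtain ⟨C, hC0, hC⟩ := exists_deriv_smoothTransition_le
  set χ := Real.smoothTransition with hχ
  have hχs : ContDiff ℝ ((⊤ : ℕ∞) : WithTop ℕ∞) χ := Real.smoothTransition.contDiff
  have hφc : Continuous φ := hφ.continuous
  have hφ'c : Continuous (deriv φ) := hφ.continuous_deriv (by simp)
  have hχ'c : Continuous (deriv χ) := hχs.continuous_deriv (by simp)
  obtain ⟨D, hD⟩ := isCompact_Icc.exists_bound_of_continuousOn (hφc.continuousOn (s := Icc 0 r))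
  have hD0 : 0 ≤ D := (norm_nonneg _).trans (hD 0 (by simp [hr0.le]))
  -- The cut-off χ(a n s) vanishes for s ≤ 1/(n+1) and equals 1 for s ≥ 2/(n+1), so its product with
  -- φ is admissible in the weak formulation.
  set a : ℕ → ℝ → ℝ := fun n s => ((n : ℝ) + 1) * s - 1 with ha
  have had : ∀ n s, HasDerivAt (a n) ((n : ℝ) + 1) s := fun n s => by
    exact (((hasDerivAt_id s).const_mul ((n : ℝ) + 1)).sub_const 1).congr_deriv (mul_one _)
  have hac : ∀ n, Continuous (a n) := fun n => by simp only [ha]; fun_prop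
  have hd : ∀ n s, deriv (fun x => χ (a n x) * φ x) s =
      χ (a n s) * deriv φ s + (((n : ℝ) + 1) * deriv χ (a n s)) * φ s := fun n s => by
    have h1 : HasDerivAt χ (deriv χ (a n s)) (a n s) :=
      ((hχs.differentiable (by simp)) _).hasDerivAt
    have h2 : HasDerivAt φ (deriv φ s) s := ((hφ.differentiable (by simp)) _).hasDerivAt
    have := ((h1.comp s (had n s)).mul h2).deriv
    rw [show (fun x => χ (a n x) * φ x) = (χ ∘ a n) * φ from rfl, this]
    simp only [Function.comp_apply]
    ring
  have key : ∀ n : ℕ, (∫ s in Ioc 0 r, (χ (a n s) * deriv φ s) • ξ s) +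
      ∫ s in Ioc 0 r, (((n : ℝ) + 1) * deriv χ (a n s) * φ s) • ξ s =
      - ∫ s in Ioc 0 r, (χ (a n s) * φ s) • ζ s := by
    intro n
    have hn : (0 : ℝ) < n + 1 := by positivity
    have hz : ∀ s, r ≤ s → χ (a n s) * φ s = 0 := fun s hs => by rw [hφr s hs, mul_zero]
    have hts : tsupport (fun x => χ (a n x) * φ x) ⊆ Icc (1 / ((n : ℝ) + 1)) r := by
      refine closure_minimal (fun s hs => ?_) isClosed_Icc
      rw [Function.mem_support] at hs
      constructor
      · by_contra! h'
        refine hs ?_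
        rw [hχ, Real.smoothTransition.zero_of_nonpos, zero_mul]
        rw [lt_div_iff₀ hn] at h'
        simp only [ha]
        linarith
      · by_contra! h'
        exact hs (hz s h'.le)
    have hw := h.weak (fun x => χ (a n x) * φ x)
      ((hχs.comp (by simp only [ha]; fun_prop)).mul hφ)
      (HasCompactSupport.of_support_subset_isCompact isCompact_Icc ((subset_tsupport _).trans hts))
      (hts.trans fun s hs => by
        have : 0 < s := lt_of_lt_of_le (by positivity) hs.1
        exact ⟨this, hμ.pos_of_le this.le hs.2 hr⟩)
    rw [setIntegral_Ioi_eq_Ioc (r := r) fun s hs => by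
        rw [deriv_eq_zero_of_forall_le hz hs, zero_smul],
      setIntegral_Ioi_eq_Ioc (r := r) fun s hs => by rw [hz s hs.le, zero_smul]] at hw
    rw [← hw, ← integral_add]
    · simp only [hd, add_smul]
    · exact hμ.integrableOn_smul hr (Lp.memLp ξ) ((hχs.continuous.comp (hac n)).mul hφ'c)
    · exact hμ.integrableOn_smul hr (Lp.memLp ξ)
        ((continuous_const.mul (hχ'c.comp (hac n))).mul hφc)
  have hlim : ∀ (ψ : ℝ → ℝ) (f : Lp X 2 (memMeasure μ)), Continuous ψ →
      Tendsto (fun n : ℕ => ∫ s in Ioc 0 r, (χ (a n s) * ψ s) • f s) atTop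
        (𝓝 (∫ s in Ioc 0 r, ψ s • f s)) := by
    intro ψ f hψ
    have hi := hμ.integrableOn_smul hr (Lp.memLp f) hψ
    refine tendsto_integral_of_dominated_convergence _ (fun n => ?_) hi.norm (fun n => ?_) ?_
    · exact (hμ.integrableOn_smul hr (Lp.memLp f)
        ((hχs.continuous.comp (hac n)).mul hψ)).aestronglyMeasurable
    · refine Eventually.of_forall fun s => ?_
      rw [mul_smul, norm_smul]
      refine mul_le_of_le_one_left (norm_nonneg _) ?_
      rw [Real.norm_of_nonneg (Real.smoothTransition.nonneg _)]
      exact Real.smoothTransition.le_one _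
    · rw [ae_restrict_iff' measurableSet_Ioc]
      refine Eventually.of_forall fun s hs => tendsto_const_nhds.congr' ?_
      obtain ⟨N, hN⟩ := exists_nat_gt (2 / s)
      filter_upwards [eventually_ge_atTop N] with n hn
      rw [hχ, Real.smoothTransition.one_of_one_le, one_mul]
      have h1 : (N : ℝ) ≤ n := by exact_mod_cast hn
      rw [div_lt_iff₀ hs.1] at hN
      simp only [ha]
      nlinarith [hs.1]
  -- The derivative of the cut-off is of size n + 1 but lives on an interval of length 2/(n+1), so
  -- its contribution is controlled by the size of ξ near 0, which tends to 0.
  have hzero : Tendsto (fun n : ℕ => ∫ s in Ioc 0 r,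
      (((n : ℝ) + 1) * deriv χ (a n s) * φ s) • ξ s) atTop (𝓝 0) := by
    obtain ⟨g, hg, hg0⟩ := h.zero
    rw [Metric.tendsto_atTop]
    intro ε hε
    -- The final bound is 2 C D η; the added 1 makes it strictly less than ε and keeps the
    -- denominator positive.
    have hη : 0 < ε / (2 * C * D + 1) := by positivity
    set η := ε / (2 * C * D + 1) with hηd
    have := (Metric.tendsto_nhds.1 hg0) η hη
    obtain ⟨d, hd0, hd⟩ := (mem_nhdsGT_iff_exists_Ioo_subset).1 this
    obtain ⟨N, hN⟩ := exists_nat_gt (2 / min d r)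
    have hm : 0 < min d r := lt_min hd0 hr0
    refine ⟨N, fun n hn => ?_⟩
    have hn0 : (0 : ℝ) < n + 1 := by positivity
    have hb : 2 / ((n : ℝ) + 1) < min d r := by
      have h1 : (N : ℝ) ≤ n := by exact_mod_cast hn
      rw [div_lt_iff₀ hm] at hN
      rw [div_lt_iff₀ hn0]
      nlinarith
    set b := 2 / ((n : ℝ) + 1) with hbd
    have hb0 : 0 < b := by positivity
    have hbn : ((n : ℝ) + 1) * b = 2 := by rw [hbd]; field_simp
    rw [dist_zero_right, setIntegral_eq_of_subset_of_forall_sdiff_eq_zero (s := Ioc 0 b)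
      measurableSet_Ioc (Ioc_subset_Ioc_right (hb.le.trans (min_le_right _ _)))]
    · have hle : ‖∫ s in Ioc 0 b, (((n : ℝ) + 1) * deriv χ (a n s) * φ s) • ξ s‖ ≤
          (((n : ℝ) + 1) * C * D * η) * volume.real (Ioc 0 b) := by
        refine norm_setIntegral_le_of_norm_le_const_ae (by simp) ?_
        have h2 := ae_restrict_of_ae_restrict_of_subset
          (Ioc_subset_Ioc_right (hb.le.trans (min_le_right _ _)))
          (hμ.ae_Ioc_of_ae_memMeasure hr hg)
        filter_upwards [h2, ae_restrict_mem measurableSet_Ioc] with s hs hsb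
        have h3 : ‖ξ s‖ ≤ η := by
          rw [← hs]
          have := hd ⟨hsb.1, hsb.2.trans_lt (hb.trans_le (min_le_left _ _))⟩
          simp only [mem_ofPred_eq, dist_zero_right] at this
          exact this.le
        have h4 : ‖φ s‖ ≤ D := hD s ⟨hsb.1.le, hsb.2.trans (hb.le.trans (min_le_right _ _))⟩
        rw [norm_smul, norm_mul, norm_mul, Real.norm_of_nonneg hn0.le]
        gcongr
        exact hC _
      refine hle.trans_lt ?_
      rw [Real.volume_real_Ioc_of_le hb0.le, sub_zero]
      have : ((n : ℝ) + 1) * C * D * η * b = 2 * C * D * η := by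
        linear_combination (C * D * η) * hbn
      rw [this, hηd, mul_div_assoc', div_lt_iff₀ (by positivity)]
      nlinarith
    · intro s hs
      have : b < s := not_le.1 fun h' => hs.2 ⟨hs.1.1, h'⟩
      rw [hχ, deriv_smoothTransition_eq_zero, mul_zero, zero_mul, zero_smul]
      simp only [ha]
      nlinarith
  have h1 := (hlim (deriv φ) ξ hφ'c).add hzero
  rw [add_zero] at h1
  exact tendsto_nhds_unique (h1.congr key) (hlim φ ζ hφc).neg

/-- Translation of a test function is differentiable for the supremum norm. -/
theorem exists_translate {φ : ℝ → ℝ} (hφ : ContDiff ℝ ((⊤ : ℕ∞) : WithTop ℕ∞) φ)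
    (hφc : HasCompactSupport φ) :
    ∃ Φ Φ' : ℝ → BoundedContinuousFunction ℝ ℝ, (∀ c s, Φ c s = φ (s + c)) ∧
      (∀ c s, Φ' c s = deriv φ (s + c)) ∧ ∀ c, HasDerivAt Φ (Φ' c) c := by
  have hcφ : Continuous φ := hφ.continuous
  have hφ1 : ContDiff ℝ ((⊤ : ℕ∞) : WithTop ℕ∞) (deriv φ) :=
    (contDiff_infty_iff_deriv.1 hφ).2
  have hcφ' : Continuous (deriv φ) := hφ1.continuous
  have hcφ'' : Continuous (deriv (deriv φ)) := hφ1.continuous_deriv (by simp)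
  obtain ⟨C, hC⟩ := hφc.exists_bound_of_continuous hcφ
  obtain ⟨C', hC'⟩ := hφc.deriv.exists_bound_of_continuous hcφ'
  obtain ⟨K, hK⟩ := hφc.deriv.deriv.exists_bound_of_continuous hcφ''
  refine ⟨fun c => .ofNormedAddCommGroup (fun s => φ (s + c)) (by fun_prop) C fun s => hC _,
    fun c => .ofNormedAddCommGroup (fun s => deriv φ (s + c)) (by fun_prop) C' fun s => hC' _,
    fun c s => rfl, fun c s => rfl, fun c => ?_⟩
  have hlip : ∀ x y, |deriv φ y - deriv φ x| ≤ K * |y - x| := fun x y =>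
    convex_univ.norm_image_sub_le_of_norm_hasDerivWithin_le (f' := deriv (deriv φ))
      (fun z _ => ((hφ1.differentiable (by simp)) z).hasDerivAt.hasDerivWithinAt)
      (fun z _ => hK z) (mem_univ x) (mem_univ y)
  have hK0 : 0 ≤ K := (norm_nonneg _).trans (hK 0)
  -- Mean value inequality for φ minus its linear part, using the Lipschitz bound on φ'. The
  -- constant does not depend on the base point, so the remainder is quadratic in the supremum norm.
  have htaylor : ∀ x y, |φ y - φ x - (y - x) * deriv φ x| ≤ K * (y - x) ^ 2 := by
    intro x y
    have := (convex_uIcc x y).norm_image_sub_le_of_norm_hasDerivWithin_le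
      (f := fun z => φ z - z * deriv φ x) (f' := fun z => deriv φ z - 1 * deriv φ x)
      (C := K * |y - x|) (x := x) (y := y)
      (fun z _ => (((hφ.differentiable (by simp)) z).hasDerivAt.sub
        ((hasDerivAt_id z).mul_const _)).hasDerivWithinAt)
      (fun z hz => by
        rw [one_mul]
        exact (hlip x z).trans (mul_le_mul_of_nonneg_left (abs_sub_left_of_mem_uIcc hz) hK0))
      left_mem_uIcc right_mem_uIcc
    rw [Real.norm_eq_abs, Real.norm_eq_abs, mul_assoc, abs_mul_abs_self] at this
    convert this using 2 <;> ring
  rw [hasDerivAt_iff_isLittleO]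
  have hO : (fun x : ℝ => (x - c) ^ 2) =o[𝓝 c] fun x => x - c := by
    have h1 : Tendsto (fun x : ℝ => x - c) (𝓝 c) (𝓝 0) := by
      have : Continuous fun x : ℝ => x - c := by fun_prop
      simpa using this.tendsto c
    have := (Asymptotics.isLittleO_pow_id (𝕜 := ℝ) one_lt_two).comp_tendsto h1
    exact this
  refine Asymptotics.IsBigO.trans_isLittleO (Asymptotics.IsBigO.of_bound K ?_) hO
  refine Eventually.of_forall fun x => ?_
  rw [BoundedContinuousFunction.norm_le (by positivity)]
  intro s
  have := htaylor (s + c) (s + x)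
  rw [show s + x - (s + c) = x - c by ring] at this
  rw [Real.norm_of_nonneg (sq_nonneg (x - c))]
  exact this

end Berger

/-! ### The transport equation for the memory -/

namespace Berger

variable {X : Type*} [NormedAddCommGroup X] [NormedSpace ℝ X] [CompleteSpace X]
  {μ : ℝ → ℝ} {δ : ℝ} {y y' : ℝ → X} {ξ ξ' : ℝ → Lp X 2 (memMeasure μ)}

theorem intervalIntegral_shift {φ : ℝ → ℝ} (hφ : Continuous φ) {r c : ℝ} (hr : 0 ≤ r) (hc : 0 ≤ c)
    (hφr : ∀ s, r ≤ s → φ s = 0) : ∫ s in Ioc 0 r, φ (s + c) = ∫ x in c..r, φ x := by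
  rw [← intervalIntegral.integral_of_le hr, intervalIntegral.integral_comp_add_right, zero_add,
    ← intervalIntegral.integral_add_adjacent_intervals (hφ.intervalIntegrable c r)
      (hφ.intervalIntegrable r (r + c)),
    intervalIntegral.integral_congr (a := r) (b := r + c) (g := fun _ => 0)]
  · simp
  · intro s hs
    rw [uIcc_of_le (by linarith)] at hs
    exact hφr s hs.1

/-- The transport equation `ξ' = -ξ_s + y'`, `ξ(0) = 0`, integrated along characteristics against
a test function. -/
theorem transport_integral (hμ : IsKernel μ δ)
    (hy : ∀ t, 0 ≤ t → HasDerivWithinAt y (y' t) (Ici 0) t)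
    (hξ : ∀ t, 0 ≤ t → HasDerivWithinAt ξ (ξ' t) (Ici 0) t)
    (hζ : ∀ t, 0 ≤ t → ∃ ζ, HasMemoryDeriv μ (ξ t) ζ ∧
      ∀ᵐ s ∂memMeasure μ, ξ' t s = - ζ s + y' t)
    {T : ℝ} (hT : 0 ≤ T) {r : ℝ} (hr0 : 0 < r) (hr : 0 < μ r)
    {φ : ℝ → ℝ} (hφ : ContDiff ℝ ((⊤ : ℕ∞) : WithTop ℕ∞) φ) (hφc : HasCompactSupport φ)
    (hφr : ∀ s, r ≤ s → φ s = 0) :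
    ∫ s in Ioc 0 r, φ s • ξ T s = (∫ s in Ioc 0 r, φ (s + T) • ξ 0 s) +
      (∫ x in (0 : ℝ)..r, φ x) • y T - (∫ x in T..r, φ x) • y 0 -
      ∫ x in (0 : ℝ)..T, φ (T - x) • y x := by
  have hcφ : Continuous φ := hφ.continuous
  obtain ⟨B, hB⟩ := hμ.exists_pairing (X := X) hr
  obtain ⟨Φ, Φ', hΦ, hΦ', hd⟩ := exists_translate hφ hφc
  -- Freezing y at negative times gives a function continuous on all of ℝ, to which the two-sided
  -- fundamental theorem of calculus applies.
  have hyc : Continuous fun x => y (max x 0) := by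
    have h1 : ContinuousOn y (Ici 0) := fun t ht => (hy t ht).continuousWithinAt
    exact h1.comp_continuous (by fun_prop) fun x => le_max_right x 0
  have hic : Continuous fun x => φ (T - x) • y (max x 0) :=
    (hcφ.comp (by fun_prop)).smul hyc
  -- The test function is carried back along characteristics, so D is constant: the derivative of
  -- the translated φ cancels the ξ_s term, the source y' is matched by the factor ∫ φ over (T - t,
  -- r), and the boundary term φ(T - t) y(t) so produced is removed by the last integral. Comparing
  -- t = 0 with t = T gives the claim.
  set D : ℝ → X := fun t => B (Φ (T - t)) (ξ t) -
    ((∫ x in (T - t)..r, φ x) • y t - ∫ x in (0 : ℝ)..t, φ (T - x) • y (max x 0)) with hD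
  have hderiv : ∀ t ∈ Icc 0 T, HasDerivWithinAt D 0 (Ici 0) t := by
    intro t ht
    have hc : 0 ≤ T - t := by linarith [ht.2]
    have h1 : HasDerivWithinAt (fun t => Φ (T - t)) (-Φ' (T - t)) (Ici 0) t := by
      have := (hd (T - t)).scomp t ((hasDerivAt_id t).const_sub T)
      rw [neg_one_smul] at this
      exact this.hasDerivWithinAt
    have h2 := ContinuousLinearMap.hasDerivWithinAt_of_bilinear (B := B) h1 (hξ t ht.1)
    have h3 : HasDerivWithinAt (fun t => ∫ x in (T - t)..r, φ x) (φ (T - t)) (Ici 0) t := by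
      have h4 : HasDerivAt (fun u => ∫ x in u..r, φ x) (-φ (T - t)) (T - t) :=
        intervalIntegral.integral_hasDerivAt_left (hcφ.intervalIntegrable _ _)
          (hcφ.stronglyMeasurableAtFilter _ _) hcφ.continuousAt
      have := h4.scomp t ((hasDerivAt_id t).const_sub T)
      simp only [neg_smul, one_smul, neg_neg] at this
      exact this.hasDerivWithinAt
    have h5 : HasDerivWithinAt (fun t => ∫ x in (0 : ℝ)..t, φ (T - x) • y (max x 0))
        (φ (T - t) • y (max t 0)) (Ici 0) t :=
      (intervalIntegral.integral_hasDerivAt_right (hic.intervalIntegrable _ _)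
          (hic.stronglyMeasurableAtFilter _ _) hic.continuousAt).hasDerivWithinAt
    rw [max_eq_left ht.1] at h5
    refine (h2.sub ((h3.smul (hy t ht.1)).sub h5)).congr_deriv ?_
    obtain ⟨ζ, hζ1, hζ2⟩ := hζ t ht.1
    have hφ2 : ContDiff ℝ ((⊤ : ℕ∞) : WithTop ℕ∞) fun s => φ (s + (T - t)) :=
      hφ.comp (by fun_prop)
    have hw := hζ1.integral_deriv_smul hμ hr0 hr hφ2 fun s hs => hφr _ (by linarith)
    simp only [deriv_comp_add_const] at hw
    have h6 : B (Φ (T - t)) (ξ' t) = - (∫ s in Ioc 0 r, φ (s + (T - t)) • ζ s) +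
        (∫ x in (T - t)..r, φ x) • y' t := by
      rw [hB, ← intervalIntegral_shift hcφ hr0.le hc hφr, ← integral_smul_const,
        ← integral_neg, ← integral_add]
      · refine integral_congr_ae ?_
        filter_upwards [hμ.ae_Ioc_of_ae_memMeasure hr hζ2] with s hs
        rw [hs, hΦ, smul_add, smul_neg]
      · exact (hμ.integrableOn_smul hr (Lp.memLp ζ) hφ2.continuous).neg
      · exact (hφ2.continuous.integrableOn_Ioc).smul_const _
    rw [h6, ← hw, map_neg, neg_apply, hB]
    simp only [hΦ']
    abel
  have hconst := constant_of_has_deriv_right_zero (f := D) (a := 0) (b := T)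
    (fun t ht => ((hderiv t ht).continuousWithinAt).mono Icc_subset_Ici_self)
    (fun t ht => (hderiv t ⟨ht.1, ht.2.le⟩).mono (Ici_subset_Ici.2 ht.1)) T ⟨hT, le_rfl⟩
  simp only [hD, hB, hΦ, sub_self, sub_zero, add_zero, intervalIntegral.integral_same] at hconst
  have h7 : ∫ x in (0 : ℝ)..T, φ (T - x) • y (max x 0) = ∫ x in (0 : ℝ)..T, φ (T - x) • y x := by
    refine intervalIntegral.integral_congr fun x hx => ?_
    rw [uIcc_of_le hT] at hx
    simp only [max_eq_left hx.1]
  rw [h7] at hconst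
  rw [sub_eq_iff_eq_add] at hconst
  rw [hconst]
  abel

/-- The set where μ > 0 is open, so there is room beyond the maximum of K. Such an r is the
truncation point needed to integrate elements of L²_μ against a test function. -/
theorem IsKernel.exists_subset_Ioo (hμ : IsKernel μ δ) (hne : {s | 0 < s ∧ 0 < μ s}.Nonempty)
    {K : Set ℝ} (hK : IsCompact K) (hKs : K ⊆ {s | 0 < s ∧ 0 < μ s}) :
    ∃ r, 0 < r ∧ 0 < μ r ∧ K ⊆ Ioo 0 r := by
  rcases K.eq_empty_or_nonempty with rfl | hKn
  · obtain ⟨r, hr⟩ := hne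
    exact ⟨r, hr.1, hr.2, empty_subset _⟩
  · have hm := hKs (hK.sSup_mem hKn)
    have h1 : ∀ᶠ r in 𝓝[>] (sSup K), r ∈ {s | 0 < s ∧ 0 < μ s} :=
      nhdsWithin_le_nhds (hμ.isOpen_support.mem_nhds hm)
    obtain ⟨r, hr, hr'⟩ := (h1.and self_mem_nhdsWithin).exists
    exact ⟨r, hr.1, hr.2, fun s hs => ⟨(hKs hs).1, (le_csSup hK.bddAbove hs).trans_lt hr'⟩⟩

/-- The representation formula for the solution of the transport equation. -/
theorem transport_formula (hμ : IsKernel μ δ)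
    (hy : ∀ t, 0 ≤ t → HasDerivWithinAt y (y' t) (Ici 0) t)
    (hξ : ∀ t, 0 ≤ t → HasDerivWithinAt ξ (ξ' t) (Ici 0) t)
    (hζ : ∀ t, 0 ≤ t → ∃ ζ, HasMemoryDeriv μ (ξ t) ζ ∧
      ∀ᵐ s ∂memMeasure μ, ξ' t s = - ζ s + y' t)
    {T : ℝ} (hT : 0 ≤ T) :
    ∀ᵐ s ∂memMeasure μ, ξ T s = y T - if s ≤ T then y (T - s) else y 0 - ξ 0 (s - T) := by
  rw [hμ.ae_memMeasure_iff]
  rcases {s | 0 < s ∧ 0 < μ s}.eq_empty_or_nonempty with he | hne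
  · refine Eventually.of_forall fun s h1 h2 => ?_
    have : s ∈ {s | 0 < s ∧ 0 < μ s} := ⟨h1, h2⟩
    rw [he] at this
    exact this.elim
  set q : ℝ → X := fun s => if s ≤ T then y (T - s) else y 0 - ξ 0 (s - T) with hq
  have hyc : ContinuousOn y (Ici 0) := fun t ht => (hy t ht).continuousWithinAt
  have hq1 : IntervalIntegrable q volume 0 T := by
    have h1 : IntervalIntegrable (fun s => y (T - s)) volume 0 T := by
      refine ContinuousOn.intervalIntegrable ?_
      rw [uIcc_of_le hT]
      exact hyc.comp (by fun_prop) fun s hs => by simpa using hs.2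
    refine h1.congr fun s hs => ?_
    rw [uIoc_of_le hT] at hs
    simp only [hq, if_pos hs.2]
  have hq2 : ∀ r, 0 < r → 0 < μ r → IntervalIntegrable q volume T (r + T) := by
    intro r hr0 hr
    have h1 : IntervalIntegrable (fun s => y 0 - ξ 0 s) volume 0 r := by
      rw [intervalIntegrable_iff_integrableOn_Ioc_of_le hr0.le]
      exact (integrable_const _).sub (hμ.integrableOn_Ioc hr (Lp.memLp _))
    have h2 := h1.comp_sub_right T
    rw [zero_add] at h2
    refine h2.congr fun s hs => ?_
    rw [uIoc_of_le (by linarith)] at hs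
    simp only [hq, if_neg (not_le.2 hs.1)]
  have hqi : ∀ r, 0 < r → 0 < μ r → IntegrableOn q (Ioc 0 (r + T)) := by
    intro r hr0 hr
    have := hq1.trans (hq2 r hr0 hr)
    rwa [intervalIntegrable_iff_integrableOn_Ioc_of_le (by linarith)] at this
  have hfi : ∀ r, 0 < r → 0 < μ r → IntegrableOn (fun s => ξ T s - (y T - q s)) (Ioc 0 r) := by
    intro r hr0 hr
    exact (hμ.integrableOn_Ioc hr (Lp.memLp _)).sub ((integrable_const _).sub
      ((hqi r hr0 hr).mono_set (Ioc_subset_Ioc_right (by linarith))))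
  -- Fundamental lemma of the calculus of variations on the open set {μ > 0}, the only place where
  -- the formula is claimed.
  have hmain := hμ.isOpen_support.ae_eq_zero_of_integral_contDiff_smul_eq_zero
    (f := fun s => ξ T s - (y T - q s)) (μ := volume) ?_ ?_
  · filter_upwards [hmain] with s hs h1 h2
    exact sub_eq_zero.1 (hs ⟨h1, h2⟩)
  · rw [locallyIntegrableOn_iff hμ.isOpen_support.isLocallyClosed]
    intro K hKs hK
    obtain ⟨r, hr0, hr, hKr⟩ := hμ.exists_subset_Ioo hne hK hKs
    exact (hfi r hr0 hr).mono_set (hKr.trans Ioo_subset_Ioc_self)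
  · intro φ hφ hφc hφs
    obtain ⟨r, hr0, hr, hKr⟩ := hμ.exists_subset_Ioo hne hφc hφs
    have hcφ : Continuous φ := hφ.continuous
    have hφ0 : ∀ s, s ≤ 0 → φ s = 0 := fun s hs => by
      by_contra h
      exact absurd (hKr (subset_tsupport _ h)).1 (not_lt.2 hs)
    have hφr : ∀ s, r ≤ s → φ s = 0 := fun s hs => by
      by_contra h
      exact absurd (hKr (subset_tsupport _ h)).2 (not_lt.2 hs)
    have htr := transport_integral hμ hy hξ hζ hT hr0 hr hφ hφc hφr
    have hqr : ∫ s in Ioc 0 r, φ s • q s = (∫ x in (0 : ℝ)..T, φ (T - x) • y x) +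
        ((∫ x in T..r, φ x) • y 0 - ∫ s in Ioc 0 r, φ (s + T) • ξ 0 s) := by
      -- Since φ vanishes beyond r, the upper limit can be raised to r + T; the split at T is then
      -- legitimate even when T > r.
      have e1 : ∫ s in Ioc 0 r, φ s • q s = ∫ s in (0 : ℝ)..(r + T), φ s • q s := by
        rw [intervalIntegral.integral_of_le (by linarith), ← setIntegral_Ioi_eq_Ioc,
          ← setIntegral_Ioi_eq_Ioc]
        · exact fun s hs => by rw [hφr s (by linarith), zero_smul]
        · exact fun s hs => by rw [hφr s hs.le, zero_smul]
      have e2 : ∫ s in (0 : ℝ)..T, φ s • q s = ∫ x in (0 : ℝ)..T, φ (T - x) • y x := by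
        have := intervalIntegral.integral_comp_sub_left (a := 0) (b := T)
          (fun x => φ x • y (T - x)) T
        simp only [sub_sub_cancel, sub_self, sub_zero] at this
        rw [this]
        refine intervalIntegral.integral_congr fun s hs => ?_
        rw [uIcc_of_le hT] at hs
        simp only [hq, if_pos hs.2]
      have e3 : ∫ s in T..(r + T), φ s • q s =
          (∫ x in T..r, φ x) • y 0 - ∫ s in Ioc 0 r, φ (s + T) • ξ 0 s := by
        have h1 : ∫ s in T..(r + T), φ s • q s =
            ∫ s in T..(r + T), φ s • (y 0 - ξ 0 (s - T)) := by
          refine intervalIntegral.integral_congr_ae (Eventually.of_forall fun s hs => ?_)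
          rw [uIoc_of_le (by linarith)] at hs
          simp only [hq, if_neg (not_le.2 hs.1)]
        have h2 := intervalIntegral.integral_comp_add_right (a := 0) (b := r)
          (fun s => φ s • (y 0 - ξ 0 (s - T))) T
        rw [zero_add] at h2
        rw [h1, ← h2, intervalIntegral.integral_of_le hr0.le,
          ← intervalIntegral_shift hcφ hr0.le hT hφr, ← integral_smul_const, ← integral_sub]
        · simp only [add_sub_cancel_right, smul_sub]
        · exact ((hcφ.comp (by fun_prop : Continuous fun s => s + T)).integrableOn_Ioc).smul_const _
        · exact hμ.integrableOn_smul hr (Lp.memLp _) (by fun_prop)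
      rw [e1, ← e2, ← e3]
      exact (intervalIntegral.integral_add_adjacent_intervals
        (hq1.continuousOn_smul hcφ.continuousOn)
        ((hq2 r hr0 hr).continuousOn_smul hcφ.continuousOn)).symm
    have hset : ∫ s, φ s • (ξ T s - (y T - q s)) =
        ∫ s in Ioc 0 r, φ s • (ξ T s - (y T - q s)) := by
      refine (setIntegral_eq_integral_of_forall_compl_eq_zero fun s hs => ?_).symm
      rw [mem_Ioc, not_and_or, not_lt, not_le] at hs
      rcases hs with hs | hs
      · rw [hφ0 s hs, zero_smul]
      · rw [hφr s hs.le, zero_smul]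
    obtain ⟨C, hC⟩ := hφc.exists_bound_of_continuous hcφ
    have hsub : IntegrableOn (fun s => φ s • q s) (Ioc 0 r) :=
      Integrable.bdd_smul ((hqi r hr0 hr).mono_set (Ioc_subset_Ioc_right (by linarith))) C
        hcφ.aestronglyMeasurable (Eventually.of_forall hC)
    rw [hset]
    simp only [smul_sub]
    have hsm : IntegrableOn (fun s => φ s • y T) (Ioc 0 r) := hcφ.integrableOn_Ioc.smul_const _
    have hdiff : IntegrableOn (fun s => φ s • y T - φ s • q s) (Ioc 0 r) := hsm.sub hsub
    rw [integral_sub (hμ.integrableOn_smul hr (Lp.memLp _) hcφ) hdiff,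
      integral_sub hsm hsub, htr, hqr, integral_smul_const, intervalIntegral.integral_of_le hr0.le]
    abel

end Berger

namespace Berger

/-! ### Volterra equations with a small kernel -/

section Volterra

variable {E : Type*} [NormedAddCommGroup E] [NormedSpace ℝ E]

theorem integrableOn_truncated_convolution {μ : ℝ → ℝ} (hμ : IntegrableOn μ (Ioi 0))
    (x : BoundedContinuousFunction ℝ E) (t : ℝ) :
    IntegrableOn (fun s => (Iic t).indicator μ s • x (t - s)) (Ioi 0) := by
  have h1 : IntegrableOn ((Iic t).indicator μ) (Ioi 0) := hμ.indicator measurableSet_Iic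
  refine (h1.norm.mul_const ‖x‖).mono' (h1.aestronglyMeasurable.smul
    (x.continuous.comp (by fun_prop)).aestronglyMeasurable) (Eventually.of_forall fun s => ?_)
  rw [norm_smul]
  gcongr
  exact x.norm_coe_le_norm _

theorem norm_truncated_convolution_le {μ : ℝ → ℝ} (hμ : IntegrableOn μ (Ioi 0))
    (hμ0 : ∀ s, 0 ≤ s → 0 ≤ μ s) (x : BoundedContinuousFunction ℝ E) (t : ℝ) :
    ‖∫ s in Ioi 0, (Iic t).indicator μ s • x (t - s)‖ ≤ (∫ s in Ioi 0, μ s) * ‖x‖ := by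
  rw [← integral_mul_const]
  refine norm_integral_le_of_norm_le (hμ.mul_const _) ?_
  rw [ae_restrict_iff' measurableSet_Ioi]
  refine Eventually.of_forall fun s hs => ?_
  rw [norm_smul]
  have h1 : ‖(Iic t).indicator μ s‖ ≤ μ s := by
    refine (norm_indicator_le_norm_self _ _).trans ?_
    rw [Real.norm_of_nonneg (hμ0 s (le_of_lt hs))]
  gcongr
  · exact hμ0 s (le_of_lt hs)
  · exact x.norm_coe_le_norm _

/-- Dominated convergence: for fixed t the integrand is continuous at t for every s except s = t, a
null set. -/
theorem continuous_truncated_convolution {μ : ℝ → ℝ} (hμ : IntegrableOn μ (Ioi 0))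
    (x : BoundedContinuousFunction ℝ E) :
    Continuous fun t => ∫ s in Ioi 0, (Iic t).indicator μ s • x (t - s) := by
  rw [continuous_iff_continuousAt]
  intro t
  refine continuousAt_of_dominated (bound := fun s => ‖μ s‖ * ‖x‖)
    (Eventually.of_forall fun u => (integrableOn_truncated_convolution hμ x u).aestronglyMeasurable)
    (Eventually.of_forall fun u => Eventually.of_forall fun s => ?_) (hμ.norm.mul_const _) ?_
  · rw [norm_smul]
    gcongr
    · exact norm_indicator_le_norm_self _ _
    · exact x.norm_coe_le_norm _
  · have : ∀ᵐ s ∂volume.restrict (Ioi (0 : ℝ)), s ≠ t :=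
      ae_restrict_of_ae (Measure.ae_ne volume t)
    filter_upwards [this] with s hs
    refine ContinuousAt.smul ?_ (x.continuous.comp (by fun_prop)).continuousAt
    rcases hs.lt_or_gt with h | h
    · refine (continuousAt_const (y := μ s)).congr ?_
      filter_upwards [Ioi_mem_nhds h] with u hu
      rw [indicator_of_mem (mem_Iic.2 (le_of_lt hu))]
    · refine (continuousAt_const (y := (0 : ℝ))).congr ?_
      filter_upwards [Iio_mem_nhds h] with u hu
      rw [indicator_of_notMem (fun h' => not_le.2 hu (mem_Iic.1 h'))]

theorem truncated_convolution_eq {μ : ℝ → ℝ} {x : ℝ → E} {t : ℝ} (ht : 0 ≤ t) :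
    ∫ s in Ioi 0, (Iic t).indicator μ s • x (t - s) = ∫ s in (0 : ℝ)..t, μ s • x (t - s) := by
  rw [intervalIntegral.integral_of_le ht, setIntegral_Ioi_eq_Ioc (r := t)]
  · refine setIntegral_congr_fun measurableSet_Ioc fun s hs => ?_
    simp only [indicator_of_mem (mem_Iic.2 hs.2)]
  · intro s hs
    rw [indicator_of_notMem (fun h' => not_le.2 hs (mem_Iic.1 h')), zero_smul]

variable [CompleteSpace E]

/-- Banach's fixed point theorem in the bounded continuous functions: the contraction factor is κ⁻¹
∫ μ < 1 whatever T is. The horizon T serves only to make the forcing bounded. -/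
theorem exists_volterra_solution {μ : ℝ → ℝ} (hμ : IntegrableOn μ (Ioi 0))
    (hμ0 : ∀ s, 0 ≤ s → 0 ≤ μ s) {κ : ℝ} (hκ : ∫ s in Ioi 0, μ s < κ) {F : ℝ → E}
    (hF : ContinuousOn F (Ici 0)) {T : ℝ} (hT : 0 ≤ T) :
    ∃ g : ℝ → E, Continuous g ∧
      ∀ t ∈ Icc 0 T, κ • g t = (∫ s in (0 : ℝ)..t, μ s • g (t - s)) + F t := by
  have hm0 : 0 ≤ ∫ s in Ioi 0, μ s := setIntegral_nonneg measurableSet_Ioi fun s hs =>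
    hμ0 s (le_of_lt hs)
  have hκ0 : 0 < κ := hm0.trans_lt hκ
  -- The forcing is frozen outside [0, T], which makes it bounded and continuous on ℝ without
  -- changing the equation on [0, T].
  set G : ℝ → E := fun t => F (max 0 (min t T)) with hG
  have hGc : Continuous G := hF.comp_continuous (by fun_prop) fun t => mem_Ici.2 (le_max_left _ _)
  obtain ⟨C, hC⟩ := isCompact_Icc.exists_bound_of_continuousOn
    (hF.mono (Icc_subset_Ici_self : Icc 0 T ⊆ Ici 0))
  have hGb : ∀ t, ‖G t‖ ≤ C := fun t =>
    hC _ ⟨le_max_left _ _, max_le hT (min_le_right _ _)⟩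
  let K : BoundedContinuousFunction ℝ E → BoundedContinuousFunction ℝ E := fun x =>
    .ofNormedAddCommGroup
      (fun t => κ⁻¹ • ((∫ s in Ioi 0, (Iic t).indicator μ s • x (t - s)) + G t))
      (((continuous_truncated_convolution hμ x).add hGc).const_smul κ⁻¹)
      (‖κ⁻¹‖ * ((∫ s in Ioi 0, μ s) * ‖x‖ + C)) fun t => by
        rw [norm_smul]
        gcongr
        exact (norm_add_le _ _).trans
          (add_le_add (norm_truncated_convolution_le hμ hμ0 x t) (hGb t))
  have hK : ContractingWith (κ⁻¹ * ∫ s in Ioi 0, μ s).toNNReal K := by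
    constructor
    · rw [← NNReal.coe_lt_coe, Real.coe_toNNReal _ (by positivity), NNReal.coe_one,
        inv_mul_lt_one₀ hκ0]
      exact hκ
    · refine LipschitzWith.of_dist_le_mul fun x z => ?_
      rw [Real.coe_toNNReal _ (by positivity), dist_eq_norm, dist_eq_norm,
        BoundedContinuousFunction.norm_le (by positivity)]
      intro t
      change ‖κ⁻¹ • ((∫ s in Ioi 0, (Iic t).indicator μ s • x (t - s)) + G t) -
        κ⁻¹ • ((∫ s in Ioi 0, (Iic t).indicator μ s • z (t - s)) + G t)‖ ≤ _
      rw [← smul_sub, add_sub_add_right_eq_sub,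
        ← integral_sub (integrableOn_truncated_convolution hμ x t)
          (integrableOn_truncated_convolution hμ z t), norm_smul, Real.norm_of_nonneg
          (inv_nonneg.2 hκ0.le), mul_assoc]
      refine mul_le_mul_of_nonneg_left ?_ (inv_nonneg.2 hκ0.le)
      simp only [← smul_sub]
      exact norm_truncated_convolution_le hμ hμ0 (x - z) t
  obtain ⟨g, hg, -⟩ := hK.exists_fixedPoint 0 (edist_ne_top _ _)
  refine ⟨g, g.continuous, fun t ht => ?_⟩
  have h1 : g t = κ⁻¹ • ((∫ s in Ioi 0, (Iic t).indicator μ s • g (t - s)) + G t) :=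
    (DFunLike.congr_fun hg t).symm
  have h2 : G t = F t := by simp only [hG, min_eq_left ht.2, max_eq_right ht.1]
  rw [truncated_convolution_eq (x := g) ht.1, h2] at h1
  rw [eq_inv_smul_iff₀ hκ0.ne'] at h1
  exact h1

/-- At a maximum point t₀ of |x| the equation yields κ |x(t₀)| ≤ (∫ μ) |x(t₀)|, which forces x(t₀) =
0. The scalar case suffices, as it is applied to each coefficient. -/
theorem volterra_unique {μ : ℝ → ℝ} (hμ : IntegrableOn μ (Ioi 0))
    (hμ0 : ∀ s, 0 ≤ s → 0 ≤ μ s) {κ : ℝ} (hκ : ∫ s in Ioi 0, μ s < κ) {T : ℝ} {x : ℝ → ℝ}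
    (hx : ContinuousOn x (Icc 0 T))
    (h : ∀ t ∈ Icc 0 T, κ * x t = ∫ s in (0 : ℝ)..t, μ s * x (t - s)) :
    ∀ t ∈ Icc 0 T, x t = 0 := by
  intro t ht
  obtain ⟨t₀, ht₀, hmax⟩ := isCompact_Icc.exists_isMaxOn ⟨t, ht⟩ hx.norm
  have hmax' : ∀ s ∈ Icc 0 T, ‖x s‖ ≤ ‖x t₀‖ := hmax
  have hm0 : 0 ≤ ∫ s in Ioi 0, μ s := setIntegral_nonneg measurableSet_Ioi fun s hs =>
    hμ0 s (le_of_lt hs)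
  have hκ0 : 0 < κ := hm0.trans_lt hκ
  have h1 : κ * ‖x t₀‖ ≤ (∫ s in Ioi 0, μ s) * ‖x t₀‖ := by
    calc κ * ‖x t₀‖ = ‖κ * x t₀‖ := by rw [norm_mul, Real.norm_of_nonneg hκ0.le]
      _ = ‖∫ s in Ioc 0 t₀, μ s * x (t₀ - s)‖ := by
        rw [h t₀ ht₀, intervalIntegral.integral_of_le ht₀.1]
      _ ≤ ∫ s in Ioc 0 t₀, μ s * ‖x t₀‖ := by
        refine norm_integral_le_of_norm_le ((hμ.mono_set Ioc_subset_Ioi_self).mul_const _) ?_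
        rw [ae_restrict_iff' measurableSet_Ioc]
        refine Eventually.of_forall fun s hs => ?_
        rw [norm_mul, Real.norm_of_nonneg (hμ0 s hs.1.le)]
        exact mul_le_mul_of_nonneg_left
          (hmax' _ ⟨by linarith [hs.2], by linarith [hs.1, ht₀.2]⟩) (hμ0 s hs.1.le)
      _ = (∫ s in Ioc 0 t₀, μ s) * ‖x t₀‖ := integral_mul_const _ _
      _ ≤ _ := by
        refine mul_le_mul_of_nonneg_right ?_ (norm_nonneg _)
        refine setIntegral_mono_set hμ ?_ (Ioc_subset_Ioi_self.eventuallyLE)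
        rw [EventuallyLE, ae_restrict_iff' measurableSet_Ioi]
        exact Eventually.of_forall fun s hs => hμ0 s (le_of_lt hs)
  have h2 : ‖x t₀‖ = 0 := by nlinarith [norm_nonneg (x t₀)]
  exact norm_eq_zero.1 (le_antisymm ((hmax' t ht).trans h2.le) (norm_nonneg _))

end Volterra

/-! ### Operators on the scale of spaces `F_s` -/

namespace SpectralOperator

variable {H : Type*} [NormedAddCommGroup H] [InnerProductSpace ℝ H] [CompleteSpace H]
  {S : SpectralOperator H} {r s t : ℝ}

theorem F.ext {x y : S.F s} (h : ∀ k, x.coeff k = y.coeff k) : x = y := Subtype.ext (funext h)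

/-- The element of `F_s` with the given coefficients. -/
def ofMem {c : ℕ → ℝ} (h : S.Mem s c) : S.F s := ⟨c, h⟩

@[simp] theorem coeff_ofMem {c : ℕ → ℝ} (h : S.Mem s c) : (ofMem h).coeff = c := (rfl)

theorem F.mem (x : S.F s) : S.Mem s x.coeff := x.2

theorem F.coeff_add (x y : S.F s) : (x + y).coeff = x.coeff + y.coeff := rfl
theorem F.coeff_sub (x y : S.F s) : (x - y).coeff = x.coeff - y.coeff := rfl
theorem F.coeff_neg (x : S.F s) : (-x).coeff = -x.coeff := rfl
theorem F.coeff_smul (c : ℝ) (x : S.F s) : (c • x).coeff = c • x.coeff := rfl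

theorem F.norm_def (x : S.F s) : ‖x‖ = ‖S.toEll s x‖ := rfl

theorem F.toEll_apply (x : S.F s) (k : ℕ) : (S.toEll s x) k = S.lam k ^ s * x.coeff k := rfl

theorem F.abs_coeff_le (x : S.F s) (k : ℕ) : |x.coeff k| ≤ S.lam k ^ (-s) * ‖x‖ := by
  have h : ‖(S.toEll s x) k‖ ≤ ‖S.toEll s x‖ := lp.norm_apply_le_norm (by norm_num) _ k
  have hk := Real.rpow_pos_of_pos (S.lam_pos k) s
  rw [← F.norm_def, F.toEll_apply, norm_mul, Real.norm_of_nonneg hk.le, Real.norm_eq_abs] at h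
  rw [Real.rpow_neg (S.lam_pos k).le, inv_mul_eq_div, le_div_iff₀ hk, mul_comm]
  exact h

/-- The `k`-th coefficient, as a linear functional on `F_s`. -/
def coeffLin (S : SpectralOperator H) (s : ℝ) (k : ℕ) : S.F s →ₗ[ℝ] ℝ where
  toFun x := x.coeff k
  map_add' _ _ := rfl
  map_smul' _ _ := rfl

/-- The `k`-th coefficient, as a continuous linear functional on `F_s`. -/
noncomputable def coeffL (S : SpectralOperator H) (s : ℝ) (k : ℕ) : S.F s →L[ℝ] ℝ :=
  (S.coeffLin s k).mkContinuous (S.lam k ^ (-s)) fun x => F.abs_coeff_le x k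

@[simp] theorem coeffL_apply (k : ℕ) (x : S.F s) : S.coeffL s k x = x.coeff k := rfl

theorem continuousOn_coeff {f : ℝ → S.F s} {D : Set ℝ} (hf : ContinuousOn f D) (k : ℕ) :
    ContinuousOn (fun t => (f t).coeff k) D :=
  (S.coeffL s k).continuous.comp_continuousOn hf

theorem coeff_incl (h : t ≤ s) (x : S.F s) : (S.incl x h).coeff = x.coeff := by
  unfold incl F.coeff
  rfl

theorem coeff_powF (h : t + r = s) (x : S.F s) : (S.powF r x h).coeff = S.pow r x.coeff := by
  unfold powF F.coeff
  rfl

theorem mem_pow (h : t + r ≤ s) (x : S.F s) : S.Mem t (S.pow r x.coeff) := by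
  have := (S.powF r (S.incl x h) rfl).mem
  rwa [coeff_powF, coeff_incl] at this

/-- The linear operator `A^r : F_s → F_t`, `t + r ≤ s`. -/
noncomputable def powLin (S : SpectralOperator H) (r s t : ℝ) (h : t + r ≤ s) :
    S.F s →ₗ[ℝ] S.F t where
  toFun x := ofMem (mem_pow h x)
  map_add' x y := F.ext fun k => mul_add (S.lam k ^ r) (x.coeff k) (y.coeff k)
  map_smul' c x := F.ext fun k => mul_left_comm (S.lam k ^ r) c (x.coeff k)

theorem coeff_powLin (h : t + r ≤ s) (x : S.F s) (k : ℕ) :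
    (S.powLin r s t h x).coeff k = S.lam k ^ r * x.coeff k := rfl

/-- Closed graph theorem: coefficients are continuous functionals that separate points, so the graph
is closed. -/
theorem continuous_powLin (h : t + r ≤ s) : Continuous (S.powLin r s t h) := by
  refine LinearMap.continuous_of_seq_closed_graph _ fun u x y hu hy => F.ext fun k => ?_
  have h1 := ((S.coeffL s k).continuous.tendsto x).comp hu
  have h2 := ((S.coeffL t k).continuous.tendsto y).comp hy
  rw [coeff_powLin]
  exact tendsto_nhds_unique h2 (h1.const_mul (S.lam k ^ r))

/-- The bounded operator `A^r : F_s → F_t`, `t + r ≤ s`. -/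
noncomputable def powL (S : SpectralOperator H) (r s t : ℝ) (h : t + r ≤ s) : S.F s →L[ℝ] S.F t :=
  ⟨S.powLin r s t h, continuous_powLin h⟩

@[simp] theorem coeff_powL (h : t + r ≤ s) (x : S.F s) (k : ℕ) :
    (S.powL r s t h x).coeff k = S.lam k ^ r * x.coeff k := rfl

theorem powF_eq_powL (h : t + r = s) (x : S.F s) : S.powF r x h = S.powL r s t h.le x :=
  F.ext fun k => by rw [coeff_powF, coeff_powL, pow]

/-- A solution of a Volterra equation whose forcing term takes values in `F_s` is itself
continuous with values in `F_s`. -/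
theorem exists_continuousOn_of_volterra {μ : ℝ → ℝ} (hμ : IntegrableOn μ (Ioi 0))
    (hμ0 : ∀ s, 0 ≤ s → 0 ≤ μ s) (hμc : ContinuousOn μ (Ici 0))
    {κ : ℝ} (hκ : ∫ s in Ioi 0, μ s < κ) {G : ℝ → S.F s}
    (hG : ContinuousOn G (Ici 0)) {x : ℝ → ℕ → ℝ} (hx : ∀ k, ContinuousOn (fun t => x t k) (Ici 0))
    (h : ∀ t, 0 ≤ t → ∀ k,
      κ * x t k = (∫ r in (0 : ℝ)..t, μ r * x (t - r) k) + (G t).coeff k) :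
    ∃ g : ℝ → S.F s, ContinuousOn g (Ici 0) ∧ ∀ t, 0 ≤ t → (g t).coeff = x t := by
  -- The equation is solved afresh in `F_s` on [0, T]; its coefficients satisfy the same scalar
  -- equations as x, hence agree with x.
  have hloc : ∀ T, 0 ≤ T → ∃ g : ℝ → S.F s, Continuous g ∧ ∀ t ∈ Icc 0 T, (g t).coeff = x t := by
    intro T hT
    obtain ⟨g, hg, hgeq⟩ := exists_volterra_solution hμ hμ0 hκ hG hT
    refine ⟨g, hg, fun t ht => funext fun k => ?_⟩
    have hgk : Continuous fun t => (g t).coeff k := (S.coeffL s k).continuous.comp hg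
    refine sub_eq_zero.1 (volterra_unique hμ hμ0 hκ (T := T)
      (x := fun t => (g t).coeff k - x t k)
      (hgk.continuousOn.sub ((hx k).mono Icc_subset_Ici_self)) (fun u hu => ?_) t ht)
    have hi1 : IntervalIntegrable (fun r => μ r • g (u - r)) volume 0 u := by
      refine ContinuousOn.intervalIntegrable ?_
      rw [uIcc_of_le hu.1]
      exact (hμc.mono Icc_subset_Ici_self).smul (hg.comp (by fun_prop)).continuousOn
    have hi2 : IntervalIntegrable (fun r => μ r * x (u - r) k) volume 0 u := by
      refine ContinuousOn.intervalIntegrable ?_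
      rw [uIcc_of_le hu.1]
      exact (hμc.mono Icc_subset_Ici_self).mul ((hx k).comp (by fun_prop)
        fun r hr => by simpa using hr.2)
    have h1 := congrArg (S.coeffL s k) (hgeq u hu)
    rw [map_smul, map_add, ← ContinuousLinearMap.intervalIntegral_comp_comm _ hi1] at h1
    simp only [map_smul, coeffL_apply, smul_eq_mul] at h1
    have hi3 : IntervalIntegrable (fun r => μ r * (g (u - r)).coeff k) volume 0 u := by
      refine ContinuousOn.intervalIntegrable ?_
      rw [uIcc_of_le hu.1]
      exact (hμc.mono Icc_subset_Ici_self).mul (hgk.comp (by fun_prop)).continuousOn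
    rw [mul_sub, h1, h u hu.1 k, add_sub_add_right_eq_sub, ← intervalIntegral.integral_sub hi3 hi2]
    simp only [mul_sub]
  have hmem : ∀ t, 0 ≤ t → S.Mem s (x t) := fun t ht => by
    obtain ⟨g, -, hg⟩ := hloc t ht
    rw [← hg t ⟨ht, le_rfl⟩]
    exact (g t).mem
  choose! g hgc hg using hloc
  -- At time t the solution on [0, t + 1] is used, so that one fixed solution covers a neighbourhood
  -- of t in [0, ∞).
  refine ⟨fun t => g (t + 1) t, fun t ht => ?_, fun t ht =>
    hg (t + 1) (by linarith) t ⟨ht, by linarith⟩⟩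
  have ht0 : 0 ≤ t := ht
  refine ((hgc (t + 1) (by linarith)).continuousWithinAt (x := t)).congr_of_eventuallyEq ?_ rfl
  filter_upwards [self_mem_nhdsWithin, nhdsWithin_le_nhds (Iio_mem_nhds (lt_add_one t))]
    with u hu hu'
  have hu0 : 0 ≤ u := hu
  refine F.ext fun k => ?_
  rw [hg (u + 1) (by linarith) u ⟨hu0, by linarith⟩, hg (t + 1) (by linarith) u ⟨hu0, le_of_lt hu'⟩]

end SpectralOperator

/-! ### The past history -/

namespace IsKernel

variable {μ : ℝ → ℝ} {δ : ℝ} {E : Type*} [NormedAddCommGroup E] [NormedSpace ℝ E]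

theorem isFiniteMeasure (hμ : IsKernel μ δ) : IsFiniteMeasure (memMeasure μ) :=
  isFiniteMeasure_withDensity_ofReal hμ.integrableOn.2

theorem integral_memMeasure (hμ : IsKernel μ δ) (f : ℝ → E) :
    ∫ s, f s ∂memMeasure μ = ∫ s in Ioi 0, μ s • f s := by
  rw [memMeasure, integral_withDensity_eq_integral_toReal_smul₀ hμ.aemeasurable.ennreal_ofReal
    (by simp)]
  refine setIntegral_congr_fun measurableSet_Ioi fun s hs => ?_
  simp only [ENNReal.toReal_ofReal (hμ.nonneg s (le_of_lt hs))]

/-- Monotonicity gives μ(s + t) ≤ μ(s), hence an integrable majorant independent of t. -/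
theorem norm_history_le (hμ : IsKernel μ δ) {h : ℝ → E}
    (hh : MemLp h ⊤ (volume.restrict (Ioi 0))) {t : ℝ} (ht : 0 ≤ t) :
    ∀ᵐ s ∂volume.restrict (Ioi 0),
      ‖μ (s + t) • h s‖ ≤ μ s * (eLpNormEssSup h (volume.restrict (Ioi 0))).toReal := by
  have htop : eLpNormEssSup h (volume.restrict (Ioi 0)) ≠ ⊤ := by
    rw [← eLpNorm_exponent_top]
    exact hh.eLpNorm_ne_top
  filter_upwards [ae_le_eLpNormEssSup (f := h) (μ := volume.restrict (Ioi 0)),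
    ae_restrict_mem measurableSet_Ioi] with s hs hs0
  have hs0' : 0 ≤ s := le_of_lt hs0
  rw [norm_smul, Real.norm_of_nonneg (hμ.nonneg _ (by linarith))]
  refine mul_le_mul (hμ.antitoneOn hs0' (mem_Ici.2 (by linarith)) (by linarith)) ?_
    (norm_nonneg _) (hμ.nonneg s hs0')
  rw [← toReal_enorm]
  exact ENNReal.toReal_mono htop hs

theorem integrableOn_history (hμ : IsKernel μ δ) {h : ℝ → E}
    (hh : MemLp h ⊤ (volume.restrict (Ioi 0))) {t : ℝ} (ht : 0 ≤ t) :
    IntegrableOn (fun s => μ (s + t) • h s) (Ioi 0) := by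
  refine (hμ.integrableOn.mul_const _).mono' (AEStronglyMeasurable.smul ?_
    hh.aestronglyMeasurable) (hμ.norm_history_le hh ht)
  refine ContinuousOn.aestronglyMeasurable ?_ measurableSet_Ioi
  refine hμ.continuousOn.comp (by fun_prop) fun s hs => ?_
  have hs0 : 0 < s := hs
  exact mem_Ici.2 (by linarith)

theorem continuousOn_history (hμ : IsKernel μ δ) {h : ℝ → E}
    (hh : MemLp h ⊤ (volume.restrict (Ioi 0))) :
    ContinuousOn (fun t => ∫ s in Ioi 0, μ (s + t) • h s) (Ici 0) := by
  intro t ht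
  refine continuousWithinAt_of_dominated
    (bound := fun s => μ s * (eLpNormEssSup h (volume.restrict (Ioi 0))).toReal) ?_ ?_
    (hμ.integrableOn.mul_const _) ?_
  · filter_upwards [self_mem_nhdsWithin] with u hu
    exact (hμ.integrableOn_history hh hu).aestronglyMeasurable
  · filter_upwards [self_mem_nhdsWithin] with u hu
    exact hμ.norm_history_le hh hu
  · filter_upwards [ae_restrict_mem measurableSet_Ioi] with s hs
    have hs0 : 0 < s := hs
    have ht0 : 0 ≤ t := ht
    refine ContinuousWithinAt.smul ?_ continuousWithinAt_const
    refine (hμ.continuousOn (s + t) (mem_Ici.2 (by linarith))).comp (by fun_prop) fun u hu => ?_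
    have hu0 : 0 ≤ u := hu
    exact mem_Ici.2 (by linarith)

/-- If μ(s) > 0 and s > t then μ(s - t) > 0 as well, so exceptional sets for the weighted measure
move to exceptional sets under the shift. -/
theorem ae_shift (hμ : IsKernel μ δ) {p : ℝ → Prop} (hp : ∀ᵐ s ∂memMeasure μ, p s) {t : ℝ}
    (ht : 0 ≤ t) : ∀ᵐ s ∂memMeasure μ, t < s → p (s - t) := by
  rw [hμ.ae_memMeasure_iff] at hp ⊢
  filter_upwards [(measurePreserving_sub_right volume t).quasiMeasurePreserving.ae hp]
    with s hs _ h2 h3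
  exact hs (sub_pos.2 h3) (hμ.pos_of_le (sub_pos.2 h3).le (by linarith) h2)

/-- The memory integral of a function with history `x` on `(0, t)` and `g` before. -/
theorem integral_history (hμ : IsKernel μ δ) {x g : ℝ → ℝ} (hx : ContinuousOn x (Ici 0)) {t : ℝ}
    (ht : 0 ≤ t) (hg : IntegrableOn (fun s => μ (s + t) * g s) (Ioi 0)) (a : ℝ) :
    ∫ s in Ioi 0, μ s * (a - if s ≤ t then x (t - s) else g (s - t)) =
      (∫ s in Ioi 0, μ s) * a - (∫ s in (0 : ℝ)..t, μ s * x (t - s)) -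
        ∫ s in Ioi 0, μ (s + t) * g s := by
  set q : ℝ → ℝ := fun s => if s ≤ t then x (t - s) else g (s - t) with hq
  have hmp := measurePreserving_add_right (volume : Measure ℝ) t
  have hme := measurableEmbedding_addRight t
  have hpre : (fun s : ℝ => s + t) ⁻¹' Ioi t = Ioi 0 := by
    ext s
    simp
  have e1 : EqOn (fun s => μ s * q s) (fun s => μ s * x (t - s)) (Ioc 0 t) := fun s hs => by
    simp only [hq, if_pos hs.2]
  have e2 : EqOn (fun s => μ s * q s) (fun s => μ s * g (s - t)) (Ioi t) := fun s hs => by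
    simp only [hq, if_neg (not_le.2 (mem_Ioi.1 hs))]
  have i1 : IntegrableOn (fun s => μ s * x (t - s)) (Ioc 0 t) := by
    rw [← intervalIntegrable_iff_integrableOn_Ioc_of_le ht]
    refine ContinuousOn.intervalIntegrable ?_
    rw [uIcc_of_le ht]
    exact (hμ.continuousOn.mono Icc_subset_Ici_self).mul
      (hx.comp (by fun_prop) fun s hs => by simpa using hs.2)
  have i2 : IntegrableOn (fun s => μ s * g (s - t)) (Ioi t) := by
    rw [← hmp.integrableOn_comp_preimage hme, hpre]
    simpa [Function.comp_def] using hg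
  have e3 : ∫ s in Ioi t, μ s * g (s - t) = ∫ s in Ioi 0, μ (s + t) * g s := by
    rw [← hmp.setIntegral_preimage_emb hme, hpre]
    simp
  have hu : Ioc 0 t ∪ Ioi t = Ioi 0 := Ioc_union_Ioi_eq_Ioi ht
  have j1 := i1.congr_fun e1.symm measurableSet_Ioc
  have j2 := i2.congr_fun e2.symm measurableSet_Ioi
  have i3 : IntegrableOn (fun s => μ s * q s) (Ioi 0) := hu ▸ j1.union j2
  simp only [mul_sub]
  rw [integral_sub (hμ.integrableOn.mul_const a) i3, integral_mul_const, sub_sub]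
  congr 1
  rw [← hu, setIntegral_union Ioc_disjoint_Ioi_same measurableSet_Ioi j1 j2,
    setIntegral_congr_fun measurableSet_Ioc e1, setIntegral_congr_fun measurableSet_Ioi e2, e3,
    hu, intervalIntegral.integral_of_le ht]

end IsKernel

/-! ### Regularity of the displacement -/

namespace PlateData

open SpectralOperator

variable {H : Type*} [NormedAddCommGroup H] [InnerProductSpace ℝ H] [CompleteSpace H]
  {S : SpectralOperator H} {P : PlateData S} {U₀ : P.Phase} {U : ℝ → P.Phase}

namespace IsClassicalSolution

/-- The time derivative of a classical solution. -/
theorem exists_derivative (hU : P.IsClassicalSolution U₀ U) :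
    ∃ D : ℝ → P.Phase, ContinuousOn D (Ici 0) ∧
      (∀ t, 0 ≤ t → HasDerivWithinAt U (D t) (Ici 0) t) ∧
      ∀ t, 0 ≤ t → ∃ V N, P.IsL (U t) V ∧ P.IsForce (U t) N ∧ D t = V + N := by
  refine ⟨derivWithin U (Ici 0), hU.contDiffOn.continuousOn_derivWithin (uniqueDiffOn_Ici 0)
    le_rfl, fun t ht => ?_, fun t ht => ?_⟩
  · obtain ⟨V, N, -, -, h⟩ := hU.equation t ht
    exact h.differentiableWithinAt.hasDerivWithinAt
  · obtain ⟨V, N, h1, h2, h⟩ := hU.equation t ht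
    exact ⟨V, N, h1, h2, h.derivWithin (uniqueDiffOn_Ici 0 t ht)⟩

end IsClassicalSolution

theorem coeff_memoryBar (V : P.Phase) (k : ℕ) :
    (P.memoryBar V).coeff k =
      S.lam k ^ (2 : ℝ) * ∫ s in Ioi 0, P.μ₁ s * (etaBar V s).coeff k := by
  have := P.kernel₁.isFiniteMeasure
  have hi : Integrable (etaBar V) (memMeasure P.μ₁) :=
    (Lp.memLp (etaBar V)).integrable (by norm_num)
  have h1 := ((S.coeffL (-1) k).comp (S.powL 2 1 (-1) (by norm_num))).integral_comp_comm hi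
  have h2 := (S.powL 2 1 (-1) (by norm_num)).integral_comp_comm hi
  simp only [memoryBar, powF_eq_powL]
  rw [h2]
  simp only [ContinuousLinearMap.comp_apply, coeffL_apply, coeff_powL] at h1
  rw [coeff_powL, ← h1, P.kernel₁.integral_memMeasure, ← integral_const_mul]
  refine integral_congr_ae (Eventually.of_forall fun s => ?_)
  simp only [smul_eq_mul]
  ring

end PlateData

/-! ### Component equations, regularity of the temperature, and the Volterra argument -/

namespace PlateData

open SpectralOperator

variable {H : Type*} [NormedAddCommGroup H] [InnerProductSpace ℝ H] [CompleteSpace H]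
  {S : SpectralOperator H} {P : PlateData S} {U₀ : P.Phase} {U : ℝ → P.Phase}

theorem hasDerivWithinAt_fst {X Y : Type*} [NormedAddCommGroup X] [NormedSpace ℝ X]
    [NormedAddCommGroup Y] [NormedSpace ℝ Y] {f : ℝ → X × Y} {f' : X × Y} {D : Set ℝ} {t : ℝ}
    (h : HasDerivWithinAt f f' D t) : HasDerivWithinAt (fun t => (f t).1) f'.1 D t :=
  (ContinuousLinearMap.fst ℝ X Y).hasFDerivAt.comp_hasDerivWithinAt t h

theorem hasDerivWithinAt_snd {X Y : Type*} [NormedAddCommGroup X] [NormedSpace ℝ X]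
    [NormedAddCommGroup Y] [NormedSpace ℝ Y] {f : ℝ → X × Y} {f' : X × Y} {D : Set ℝ} {t : ℝ}
    (h : HasDerivWithinAt f f' D t) : HasDerivWithinAt (fun t => (f t).2) f'.2 D t :=
  (ContinuousLinearMap.snd ℝ X Y).hasFDerivAt.comp_hasDerivWithinAt t h

/-- The component equations satisfied by the time derivative `D t` of a solution `U`. -/
structure IsDerivative (P : PlateData S) (U D : ℝ → P.Phase) : Prop where
  continuousOn : ContinuousOn D (Ici 0)
  hasDeriv : ∀ t, 0 ≤ t → HasDerivWithinAt U (D t) (Ici 0) t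
  dom : ∀ t, 0 ≤ t → P.InDomain (U t)
  u_eq : ∀ t, 0 ≤ t → (u (D t)).coeff = (w (U t)).coeff
  w_eq : ∀ t, 0 ≤ t → ∃ N, P.IsForce (U t) N ∧ (w (D t)).coeff = -P.elasticPart (U t) + (w N).coeff
  v_eq : ∀ t, 0 ≤ t → (v (D t)).coeff = -P.thermalPart (U t) - P.ν • S.pow 1 (w (U t)).coeff
  etaBar_eq : ∀ t, 0 ≤ t → ∃ ζ, HasMemoryDeriv P.μ₁ (etaBar (U t)) ζ ∧
    ∀ᵐ s ∂memMeasure P.μ₁, etaBar (D t) s = -ζ s + u (D t)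
  eta_eq : ∀ t, 0 ≤ t → ∃ ζ, HasMemoryDeriv P.μ₂ (eta (U t)) ζ ∧
    ∀ᵐ s ∂memMeasure P.μ₂, (eta (D t) s).coeff = -(ζ s).coeff + (v (U t)).coeff

theorem IsClassicalSolution.exists_isDerivative (hU : P.IsClassicalSolution U₀ U) :
    ∃ D, P.IsDerivative U D := by
  obtain ⟨D, hDc, hD, hVN⟩ := hU.exists_derivative
  have hu : ∀ t, 0 ≤ t → (u (D t)).coeff = (w (U t)).coeff := fun t ht => by
    obtain ⟨V, N, hV, hN, h⟩ := hVN t ht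
    have : u (D t) = u V + u N := by rw [h]; rfl
    rw [this, hN.u_eq, add_zero, hV.u_eq]
  refine ⟨D, hDc, hD, fun t ht => ?_, hu, fun t ht => ?_, fun t ht => ?_, fun t ht => ?_,
    fun t ht => ?_⟩ <;> obtain ⟨V, N, hV, hN, h⟩ := hVN t ht
  · exact hV.dom
  · have : w (D t) = w V + w N := by rw [h]; rfl
    exact ⟨N, hN, by rw [this, F.coeff_add, hV.w_eq]⟩
  · have : v (D t) = v V + v N := by rw [h]; rfl
    rw [this, hN.v_eq, add_zero, hV.v_eq]
  · have : etaBar (D t) = etaBar V + etaBar N := by rw [h]; rfl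
    rw [this, hN.etaBar_eq, add_zero]
    obtain ⟨ζ, h1, h2⟩ := hV.etaBar_eq
    refine ⟨ζ, h1, ?_⟩
    filter_upwards [h2] with s hs
    refine F.ext fun k => ?_
    rw [hs, F.coeff_add, F.coeff_neg, hu t ht]
  · have : eta (D t) = eta V + eta N := by rw [h]; rfl
    rw [this, hN.eta_eq, add_zero]
    exact hV.eta_eq

namespace IsDerivative

variable {D : ℝ → P.Phase}

theorem hasDeriv_u (hD : P.IsDerivative U D) {t : ℝ} (ht : 0 ≤ t) :
    HasDerivWithinAt (fun t => u (U t)) (u (D t)) (Ici 0) t :=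
  hasDerivWithinAt_fst (hD.hasDeriv t ht)

theorem hasDeriv_v (hD : P.IsDerivative U D) {t : ℝ} (ht : 0 ≤ t) :
    HasDerivWithinAt (fun t => v (U t)) (v (D t)) (Ici 0) t :=
  hasDerivWithinAt_fst (hasDerivWithinAt_snd (hasDerivWithinAt_snd (hD.hasDeriv t ht)))

theorem hasDeriv_etaBar (hD : P.IsDerivative U D) {t : ℝ} (ht : 0 ≤ t) :
    HasDerivWithinAt (fun t => etaBar (U t)) (etaBar (D t)) (Ici 0) t :=
  hasDerivWithinAt_fst (hasDerivWithinAt_snd (hasDerivWithinAt_snd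
    (hasDerivWithinAt_snd (hD.hasDeriv t ht))))

theorem continuousOn_solution (hD : P.IsDerivative U D) : ContinuousOn U (Ici 0) :=
  fun t ht => (hD.hasDeriv t ht).continuousWithinAt

theorem continuousOn_u (hD : P.IsDerivative U D) : ContinuousOn (fun t => u (U t)) (Ici 0) :=
  hD.continuousOn_solution.fst

theorem continuousOn_eta (hD : P.IsDerivative U D) : ContinuousOn (fun t => eta (U t)) (Ici 0) :=
  hD.continuousOn_solution.snd.snd.snd.snd

/-- The elastic equation, written as a Volterra equation for the coefficients of `u`. -/
theorem volterra_coeff (hD : P.IsDerivative U D) {h : ℝ → S.F (3 / 2)}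
    (hh : MemLp h ⊤ (volume.restrict (Ioi 0)))
    (hh' : ∀ᵐ s ∂memMeasure P.μ₁, (h s).coeff = (u (U 0) - etaBar (U 0) s).coeff)
    {t : ℝ} (ht : 0 ≤ t) (k : ℕ) :
    (P.β + ∫ s in Ioi 0, P.μ₁ s) * (u (U t)).coeff k =
      (∫ s in (0 : ℝ)..t, P.μ₁ s * (u (U (t - s))).coeff k) +
        ((∫ s in Ioi 0, P.μ₁ (s + t) • h s : S.F (3 / 2)).coeff k +
          (S.lam k ^ (-2 : ℝ) * P.elasticPart (U t) k +
            P.ν * (S.lam k ^ (-1 : ℝ) * (v (U t)).coeff k))) := by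
  have hμ := P.kernel₁
  have hform := transport_formula hμ (fun t ht => hD.hasDeriv_u ht)
    (fun t ht => hD.hasDeriv_etaBar ht) hD.etaBar_eq ht
  have hshift := hμ.ae_shift hh' ht
  have hcoeff : ∀ᵐ s ∂memMeasure P.μ₁, (etaBar (U t) s).coeff k =
      (u (U t)).coeff k - if s ≤ t then (u (U (t - s))).coeff k else (h (s - t)).coeff k := by
    filter_upwards [hform, hshift] with s h1 h2
    rw [h1]
    split_ifs with hs
    · rfl
    · rw [h2 (not_le.1 hs)]
      rfl
  have hint := hμ.integrableOn_history hh ht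
  have hik : ∫ s in Ioi 0, P.μ₁ (s + t) * (h s).coeff k =
      (∫ s in Ioi 0, P.μ₁ (s + t) • h s : S.F (3 / 2)).coeff k := by
    have := (S.coeffL (3 / 2) k).integral_comp_comm hint
    simpa only [map_smul, coeffL_apply, smul_eq_mul] using this
  have hink : IntegrableOn (fun s => P.μ₁ (s + t) * (h s).coeff k) (Ioi 0) := by
    have := (S.coeffL (3 / 2) k).integrable_comp hint
    simp only [map_smul, coeffL_apply, smul_eq_mul] at this
    exact this
  have hmem : ∫ s in Ioi 0, P.μ₁ s * (etaBar (U t) s).coeff k =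
      (∫ s in Ioi 0, P.μ₁ s) * (u (U t)).coeff k -
        (∫ s in (0 : ℝ)..t, P.μ₁ s * (u (U (t - s))).coeff k) -
        (∫ s in Ioi 0, P.μ₁ (s + t) • h s : S.F (3 / 2)).coeff k := by
    rw [← hik, ← hμ.integral_history (x := fun t => (u (U t)).coeff k)
      (g := fun s => (h s).coeff k) (continuousOn_coeff hD.continuousOn_u k) ht hink]
    refine setIntegral_congr_ae measurableSet_Ioi ?_
    filter_upwards [hμ.ae_memMeasure_iff.1 hcoeff] with s hs hs0
    -- The representation of η̄ is known only where μ₁ > 0; elsewhere both integrands vanish.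
    rcases (hμ.nonneg s (le_of_lt hs0)).eq_or_lt with h0 | h0
    · rw [← h0, zero_mul, zero_mul]
    · rw [hs hs0 h0]
  have hel : P.elasticPart (U t) k = P.β * (S.lam k ^ (2 : ℝ) * (u (U t)).coeff k) +
      S.lam k ^ (2 : ℝ) * (∫ s in Ioi 0, P.μ₁ s * (etaBar (U t) s).coeff k) -
      P.ν * (S.lam k ^ (1 : ℝ) * (v (U t)).coeff k) := by
    rw [← coeff_memoryBar]
    rfl
  have hl := S.lam_pos k
  have l2 : S.lam k ^ (-2 : ℝ) * S.lam k ^ (2 : ℝ) = 1 := by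
    rw [← Real.rpow_add hl]; norm_num
  have l1 : S.lam k ^ (-2 : ℝ) * S.lam k ^ (1 : ℝ) = S.lam k ^ (-1 : ℝ) := by
    rw [← Real.rpow_add hl]; norm_num
  rw [hel, hmem, ← l1]
  linear_combination (-(P.β * (u (U t)).coeff k + (∫ s in Ioi 0, P.μ₁ s) * (u (U t)).coeff k -
        (∫ s in (0 : ℝ)..t, P.μ₁ s * (u (U (t - s))).coeff k) -
        (∫ s in Ioi 0, P.μ₁ (s + t) • h s : S.F (3 / 2)).coeff k)) * l2

/-- The elastic part of a solution is continuous with values in `F_0`. -/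
theorem exists_elastic (hD : P.IsDerivative U D) :
    ∃ G : ℝ → S.F 0, ContinuousOn G (Ici 0) ∧
      ∀ t, 0 ≤ t → (G t).coeff = P.elasticPart (U t) := by
  set L := S.powL (1 / 2) 1 0 (by norm_num)
  set m : ℝ → S.F 0 := fun t => P.M (‖L (u (U t))‖ ^ 2) • S.powL 1 1 0 (by norm_num) (u (U t))
    with hm
  have hforce : ∀ t N, P.IsForce (U t) N → (w N).coeff = -(m t).coeff + S.coeffH P.p := by
    intro t N hN
    have h1 : (S.incl (S.powF (1 / 2) (u (U t)) : S.F (1 / 2)) : S.F 0) = L (u (U t)) :=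
      F.ext fun k => by rw [coeff_incl, coeff_powF, coeff_powL, pow]
    rw [hN.w_eq, h1]
    funext k
    simp only [hm, F.coeff_smul, Pi.add_apply, Pi.smul_apply, Pi.neg_apply, coeff_powL, pow,
      neg_smul]
  obtain ⟨N₀, hN₀, -⟩ := hD.w_eq 0 le_rfl
  have hu := hD.continuousOn_u
  have hmc : ContinuousOn m (Ici 0) := by
    have h1 : ContinuousOn (fun t => P.M (‖L (u (U t))‖ ^ 2)) (Ici 0) :=
      P.M_cont.comp ((L.continuous.comp_continuousOn hu).norm.pow 2) fun t _ =>
        mem_Ici.2 (sq_nonneg _)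
    exact h1.smul ((S.powL 1 1 0 (by norm_num)).continuous.comp_continuousOn hu)
  -- The equation for `w` reads elastic part = -m + p - w'. The load enters through its coefficients
  -- only; w N₀ + m 0 realises it as an element of `F_0`.
  refine ⟨fun t => -m t + (w N₀ + m 0) - w (D t), ?_, fun t ht => ?_⟩
  · exact (hmc.neg.add continuousOn_const).sub hD.continuousOn.snd.fst
  · obtain ⟨N, hN, h⟩ := hD.w_eq t ht
    rw [F.coeff_sub, F.coeff_add, F.coeff_add, F.coeff_neg, h, hforce _ _ hN, hforce _ _ hN₀]
    abel

/-- Testing η' = -η_s + v with a bump f supported in (0, r) gives (∫ f) v = ∫ f η' - ∫ f' η, whose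
right-hand side is continuous in `F_{1/2}`. -/
theorem exists_v_of_kernel_pos (hD : P.IsDerivative U D) {r : ℝ} (hr0 : 0 < r)
    (hr : 0 < P.μ₂ r) :
    ∃ g : ℝ → S.F (1 / 2), ContinuousOn g (Ici 0) ∧ ∀ t, 0 ≤ t → (g t).coeff = (v (U t)).coeff := by
  have hμ := P.kernel₂
  obtain ⟨B, hB⟩ := hμ.exists_pairing (X := S.F (1 / 2)) hr
  let f : ContDiffBump (r / 2) := ⟨r / 8, r / 4, by positivity, by linarith⟩
  obtain ⟨Φ, Φ', hΦ, hΦ', -⟩ := exists_translate (φ := f) f.contDiff f.hasCompactSupport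
  have hfs : tsupport f ⊆ Ioo 0 r := by
    rw [f.tsupport_eq, Real.closedBall_eq_Icc]
    intro s hs
    have h1 : r / 2 - r / 4 ≤ s := hs.1
    have h2 : s ≤ r / 2 + r / 4 := hs.2
    constructor <;> linarith
  have hf0 : ∀ s, s ∉ Ioo 0 r → f s = 0 := fun s hs => by
    by_contra h
    exact hs (hfs (subset_tsupport _ h))
  have hI : 0 < ∫ s in Ioc 0 r, f s := by
    have h1 : ∫ s in Ioc 0 r, f s = ∫ s, f s :=
      setIntegral_eq_integral_of_forall_compl_eq_zero fun s hs =>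
        hf0 s fun h => hs (Ioo_subset_Ioc_self h)
    rw [h1]
    exact f.integral_pos
  have hDeta : ContinuousOn (fun t => eta (D t)) (Ici 0) := hD.continuousOn.snd.snd.snd.snd
  have hUeta := hD.continuousOn_eta
  refine ⟨fun t => (∫ s in Ioc 0 r, f s)⁻¹ • (B (Φ 0) (eta (D t)) - B (Φ' 0) (eta (U t))),
    by fun_prop, fun t ht => ?_⟩
  obtain ⟨ζ, hζ, hae⟩ := hD.eta_eq t ht
  have hw := hζ.integral_deriv_smul hμ hr0 hr f.contDiff fun s hs =>
    hf0 s fun h => absurd h.2 (not_lt.2 hs)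
  have hvm := (hD.dom t ht).v_mem
  have h1 : B (Φ 0) (eta (D t)) =
      - (∫ s in Ioc 0 r, f s • ζ s) + (∫ s in Ioc 0 r, f s) • ofMem hvm := by
    rw [hB, ← integral_smul_const, ← integral_neg, ← integral_add]
    · refine integral_congr_ae ?_
      filter_upwards [hμ.ae_Ioc_of_ae_memMeasure hr hae] with s hs
      have : eta (D t) s = -ζ s + ofMem hvm := F.ext fun k => by
        rw [hs, F.coeff_add, F.coeff_neg, coeff_ofMem]
      rw [this, hΦ, add_zero, smul_add, smul_neg]
    · exact (hμ.integrableOn_smul hr (Lp.memLp ζ) f.continuous).neg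
    · exact f.continuous.integrableOn_Ioc.smul_const _
  have h2 : B (Φ' 0) (eta (U t)) = ∫ s in Ioc 0 r, deriv f s • eta (U t) s := by
    rw [hB]
    simp only [hΦ', add_zero]
  have h3 : B (Φ 0) (eta (D t)) - B (Φ' 0) (eta (U t)) =
      (∫ s in Ioc 0 r, f s) • ofMem hvm := by
    rw [h1, h2, hw]
    abel
  change ((∫ s in Ioc 0 r, f s)⁻¹ • (B (Φ 0) (eta (D t)) - B (Φ' 0) (eta (U t)))).coeff = _
  rw [h3, inv_smul_smul₀ hI.ne', coeff_ofMem]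

theorem memory_eq_zero (h : ∀ s, 0 < s → P.μ₂ s = 0) (V : P.Phase) : P.memory V = 0 := by
  rw [memory, P.kernel₂.integral_memMeasure]
  exact setIntegral_eq_zero_of_forall_eq_zero fun s hs => by rw [h s hs, zero_smul]

/-- Without thermal memory, v' = -ω A v - ν A w can be solved for `v`. Here w = u' is continuous in
`F_1`, since the solution is C¹ in the phase space, and A⁻¹ v' is continuous in `F_1`. -/
theorem exists_v_of_pos (hD : P.IsDerivative U D) (h : ∀ s, 0 < s → P.μ₂ s = 0) (hω : 0 < P.ω) :
    ∃ g : ℝ → S.F (1 / 2), ContinuousOn g (Ici 0) ∧ ∀ t, 0 ≤ t → (g t).coeff = (v (U t)).coeff := by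
  have hDu : ContinuousOn (fun t => u (D t)) (Ici 0) := hD.continuousOn.fst
  have hDv : ContinuousOn (fun t => v (D t)) (Ici 0) := hD.continuousOn.snd.snd.fst
  refine ⟨fun t => P.ω⁻¹ • (-S.powL (-1) 0 (1 / 2) (by norm_num) (v (D t)) -
    P.ν • S.powL 0 1 (1 / 2) (by norm_num) (u (D t))), by fun_prop, fun t ht => funext fun k => ?_⟩
  · have h1 := congrFun (hD.v_eq t ht) k
    rw [thermalPart, memory_eq_zero h] at h1
    have h2 : (v (D t)).coeff k = -(P.ω * (S.lam k ^ (1 : ℝ) * (v (U t)).coeff k) + 0) -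
      P.ν * (S.lam k ^ (1 : ℝ) * (w (U t)).coeff k) := h1
    have hl := S.lam_pos k
    simp only [F.coeff_smul, F.coeff_sub, F.coeff_neg, Pi.smul_apply, Pi.sub_apply, Pi.neg_apply,
      coeff_powL, smul_eq_mul, hD.u_eq t ht, h2, Real.rpow_neg_one, Real.rpow_one, Real.rpow_zero]
    field_simp
    ring

/-- With neither thermal memory nor diffusion the equation reduces to v' = -ν A u', so v + ν A u is
conserved. -/
theorem v_add_eq (hD : P.IsDerivative U D) (h : ∀ s, 0 < s → P.μ₂ s = 0) (hω : P.ω = 0)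
    {t : ℝ} (ht : 0 ≤ t) (k : ℕ) :
    (v (U t)).coeff k + P.ν * (S.lam k * (u (U t)).coeff k) =
      (v (U 0)).coeff k + P.ν * (S.lam k * (u (U 0)).coeff k) := by
  have hd : ∀ s, 0 ≤ s → HasDerivWithinAt
      (fun s => (v (U s)).coeff k + P.ν * (S.lam k * (u (U s)).coeff k)) 0 (Ici 0) s := by
    intro s hs
    have h1 : HasDerivWithinAt (fun s => (v (U s)).coeff k) ((v (D s)).coeff k) (Ici 0) s :=
      (S.coeffL 0 k).hasFDerivAt.comp_hasDerivWithinAt s (hD.hasDeriv_v hs)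
    have h2 : HasDerivWithinAt (fun s => (u (U s)).coeff k) ((u (D s)).coeff k) (Ici 0) s :=
      (S.coeffL 1 k).hasFDerivAt.comp_hasDerivWithinAt s (hD.hasDeriv_u hs)
    refine (h1.add ((h2.const_mul (S.lam k)).const_mul P.ν)).congr_deriv ?_
    have h3 := congrFun (hD.v_eq s hs) k
    rw [thermalPart, memory_eq_zero h, hω] at h3
    have h4 : (v (D s)).coeff k = -(0 * (S.lam k ^ (1 : ℝ) * (v (U s)).coeff k) + 0) -
      P.ν * (S.lam k ^ (1 : ℝ) * (w (U s)).coeff k) := h3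
    rw [h4, hD.u_eq s hs, Real.rpow_one]
    ring
  exact constant_of_has_deriv_right_zero
    (f := fun s => (v (U s)).coeff k + P.ν * (S.lam k * (u (U s)).coeff k)) (a := 0) (b := t)
    (fun s hs => ((hd s hs.1).continuousWithinAt).mono Icc_subset_Ici_self)
    (fun s hs => (hd s hs.1).mono (Ici_subset_Ici.2 hs.1)) t ⟨ht, le_rfl⟩

end IsDerivative

/-- The displacement is continuous with values in `F_{3/2}` if `v` is so with values in
`F_{1/2}`. -/
theorem IsDerivative.exists_lift_of_v {D : ℝ → P.Phase} (hD : P.IsDerivative U D)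
    {h : ℝ → S.F (3 / 2)} (hh : MemLp h ⊤ (volume.restrict (Ioi 0)))
    (hh' : ∀ᵐ s ∂memMeasure P.μ₁, (h s).coeff = (u (U 0) - etaBar (U 0) s).coeff)
    {g : ℝ → S.F (1 / 2)} (hg : ContinuousOn g (Ici 0))
    (hge : ∀ t, 0 ≤ t → (g t).coeff = (v (U t)).coeff) :
    ∃ g : ℝ → S.F (3 / 2), ContinuousOn g (Ici 0) ∧
      ∀ t, 0 ≤ t → (g t).coeff = (u (U t)).coeff := by
  have hμ := P.kernel₁
  obtain ⟨G, hG, hGe⟩ := hD.exists_elastic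
  have hhist := hμ.continuousOn_history hh
  have hx := fun k => continuousOn_coeff hD.continuousOn_u k
  refine exists_continuousOn_of_volterra hμ.integrableOn hμ.nonneg hμ.continuousOn
    -- Positivity of β is exactly the strict gap between the factor and the mass of the kernel.
    (κ := P.β + ∫ s in Ioi 0, P.μ₁ s) (by linarith [P.β_pos])
    (G := fun t => (∫ s in Ioi 0, P.μ₁ (s + t) • h s) +
      (S.powL (-2) 0 (3 / 2) (by norm_num) (G t) +
        P.ν • S.powL (-1) (1 / 2) (3 / 2) (by norm_num) (g t))) (by fun_prop) hx ?_
  intro t ht k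
  rw [hD.volterra_coeff hh hh' ht k, F.coeff_add, F.coeff_add, F.coeff_smul]
  simp only [Pi.add_apply, Pi.smul_apply, smul_eq_mul, coeff_powL, hGe t ht, hge t ht]

/-- At t = 0 the Volterra integral is empty, so the equation is an explicit formula for `u(0)` with
all terms in `F_{3/2}`. -/
theorem IsDerivative.mem_initial {D : ℝ → P.Phase} (hD : P.IsDerivative U D)
    {h : ℝ → S.F (3 / 2)} (hh : MemLp h ⊤ (volume.restrict (Ioi 0)))
    (hh' : ∀ᵐ s ∂memMeasure P.μ₁, (h s).coeff = (u (U 0) - etaBar (U 0) s).coeff) :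
    S.Mem (3 / 2) (u (U 0)).coeff := by
  have hμ := P.kernel₁
  obtain ⟨G, hG, hGe⟩ := hD.exists_elastic
  have hv0 : S.Mem (1 / 2) (v (U 0)).coeff := (hD.dom 0 le_rfl).v_mem
  have hκ0 : 0 < P.β + ∫ s in Ioi 0, P.μ₁ s := by
    have : 0 ≤ ∫ s in Ioi 0, P.μ₁ s :=
      setIntegral_nonneg measurableSet_Ioi fun s hs => hμ.nonneg s (le_of_lt hs)
    linarith [P.β_pos]
  set z : S.F (3 / 2) := (P.β + ∫ s in Ioi 0, P.μ₁ s)⁻¹ •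
    ((∫ s in Ioi 0, P.μ₁ (s + 0) • h s) + (S.powL (-2) 0 (3 / 2) (by norm_num) (G 0) +
      P.ν • S.powL (-1) (1 / 2) (3 / 2) (by norm_num) (ofMem hv0))) with hzd
  have hz0 : z.coeff = (u (U 0)).coeff := by
    funext k
    have := hD.volterra_coeff hh hh' le_rfl k
    rw [intervalIntegral.integral_same, zero_add] at this
    rw [hzd, F.coeff_smul, F.coeff_add, F.coeff_add, F.coeff_smul]
    simp only [Pi.add_apply, Pi.smul_apply, smul_eq_mul, coeff_powL, hGe 0 le_rfl, coeff_ofMem]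
    rw [inv_mul_eq_iff_eq_mul₀ hκ0.ne', this]
  rw [← hz0]
  exact z.mem

/-- The conservation law gives ν A⁻¹ v(t) = ν A⁻¹ v(0) + ν² u(0) - ν² u(t). The last term moves to
the left and enlarges the factor; the other two are constant forcing in `F_{3/2}`. -/
theorem IsDerivative.exists_lift_of_eq_zero {D : ℝ → P.Phase} (hD : P.IsDerivative U D)
    {h : ℝ → S.F (3 / 2)} (hh : MemLp h ⊤ (volume.restrict (Ioi 0)))
    (hh' : ∀ᵐ s ∂memMeasure P.μ₁, (h s).coeff = (u (U 0) - etaBar (U 0) s).coeff)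
    (hz : ∀ s, 0 < s → P.μ₂ s = 0) (hω : P.ω = 0) :
    ∃ g : ℝ → S.F (3 / 2), ContinuousOn g (Ici 0) ∧
      ∀ t, 0 ≤ t → (g t).coeff = (u (U t)).coeff := by
  have hμ := P.kernel₁
  obtain ⟨G, hG, hGe⟩ := hD.exists_elastic
  have hhist := hμ.continuousOn_history hh
  have hx := fun k => continuousOn_coeff hD.continuousOn_u k
  have hv0 : S.Mem (1 / 2) (v (U 0)).coeff := (hD.dom 0 le_rfl).v_mem
  have hu0 := hD.mem_initial hh hh'
  refine exists_continuousOn_of_volterra hμ.integrableOn hμ.nonneg hμ.continuousOn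
    (κ := P.β + (∫ s in Ioi 0, P.μ₁ s) + P.ν ^ 2) (by linarith [P.β_pos, sq_nonneg P.ν])
    (G := fun t => (∫ s in Ioi 0, P.μ₁ (s + t) • h s) +
      (S.powL (-2) 0 (3 / 2) (by norm_num) (G t) +
        P.ν • (S.powL (-1) (1 / 2) (3 / 2) (by norm_num) (ofMem hv0) + P.ν • ofMem hu0)))
    (by fun_prop) hx ?_
  intro t ht k
  have hc := hD.v_add_eq hz hω ht k
  rw [add_mul, hD.volterra_coeff hh hh' ht k, F.coeff_add, F.coeff_add, F.coeff_smul, F.coeff_add,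
    F.coeff_smul]
  simp only [Pi.add_apply, Pi.smul_apply, smul_eq_mul, coeff_powL, hGe t ht, coeff_ofMem]
  have hl : S.lam k ^ (-1 : ℝ) * S.lam k = 1 := by
    rw [Real.rpow_neg_one, inv_mul_cancel₀ (S.lam_pos k).ne']
  linear_combination (P.ν * S.lam k ^ (-1 : ℝ)) * hc +
    (P.ν ^ 2 * (u (U 0)).coeff k - P.ν ^ 2 * (u (U t)).coeff k) * hl

theorem exists_lift (hP : P.BoundedPastHistory U₀) (hU : P.IsClassicalSolution U₀ U) :
    ∃ g : ℝ → S.F (3 / 2), ContinuousOn g (Ici 0) ∧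
      ∀ t, 0 ≤ t → (g t).coeff = (u (U t)).coeff := by
  obtain ⟨D, hD⟩ := hU.exists_isDerivative
  obtain ⟨h, hh, hh'⟩ := hP
  rw [← hU.init] at hh'
  by_cases hr : ∃ r, 0 < r ∧ 0 < P.μ₂ r
  · obtain ⟨r, hr0, hr⟩ := hr
    obtain ⟨g, hg, hge⟩ := hD.exists_v_of_kernel_pos hr0 hr
    exact hD.exists_lift_of_v hh hh' hg hge
  · have hz : ∀ s, 0 < s → P.μ₂ s = 0 := fun s hs =>
      le_antisymm (not_lt.1 fun h' => hr ⟨s, hs, h'⟩) (P.kernel₂.nonneg s hs.le)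
    rcases P.ω_nonneg.eq_or_lt with hω | hω
    · exact hD.exists_lift_of_eq_zero hh hh' hz hω.symm
    · obtain ⟨g, hg, hge⟩ := hD.exists_v_of_pos hz hω
      exact hD.exists_lift_of_v hh hh' hg hge

theorem displacementContinuous (hP : P.BoundedPastHistory U₀) (hU : P.IsClassicalSolution U₀ U) :
    P.DisplacementContinuous U := by
  obtain ⟨g, hg, hge⟩ := exists_lift hP hU
  refine ⟨g, hg, fun t ht => F.ext fun k => ?_⟩
  rw [coeff_incl, hge t ht]

end PlateData

/-! ### The Dirichlet Laplacian -/

section Dirichlet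

variable {Ω : Set E2}

namespace IsTest

variable {φ ψ : E2 → ℝ}

theorem continuous_partialDeriv (h : IsTest Ω φ) (i : Fin 2) : Continuous (partialDeriv i φ) :=
  (h.smooth.continuous_fderiv (by simp)).clm_apply continuous_const

theorem hasCompactSupport_partialDeriv (h : IsTest Ω φ) (i : Fin 2) :
    HasCompactSupport (partialDeriv i φ) :=
  h.compact.fderiv_apply (𝕜 := ℝ) _

theorem memLp (h : IsTest Ω φ) : MemLp φ 2 (volume.restrict Ω) :=
  h.smooth.continuous.memLp_of_hasCompactSupport h.compact

theorem memLp_partialDeriv (h : IsTest Ω φ) (i : Fin 2) :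
    MemLp (partialDeriv i φ) 2 (volume.restrict Ω) :=
  (h.continuous_partialDeriv i).memLp_of_hasCompactSupport (h.hasCompactSupport_partialDeriv i)

theorem zero : IsTest Ω 0 where
  smooth := contDiff_const
  compact := HasCompactSupport.zero
  supp := by simp [tsupport]

theorem add (h : IsTest Ω φ) (h' : IsTest Ω ψ) : IsTest Ω (φ + ψ) where
  smooth := h.smooth.add h'.smooth
  compact := h.compact.add h'.compact
  supp := (tsupport_add φ ψ).trans (union_subset h.supp h'.supp)

theorem smul (h : IsTest Ω φ) (c : ℝ) : IsTest Ω (c • φ) where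
  smooth := h.smooth.const_smul c
  compact := h.compact.smul_left (f := fun _ => c)
  supp := (closure_mono (Function.support_const_smul_subset c φ)).trans h.supp

theorem partialDeriv_add (h : IsTest Ω φ) (h' : IsTest Ω ψ) (i : Fin 2) :
    partialDeriv i (φ + ψ) = partialDeriv i φ + partialDeriv i ψ := by
  funext x
  simp only [partialDeriv, Pi.add_apply]
  rw [fderiv_add (h.smooth.differentiable (by simp) x) (h'.smooth.differentiable (by simp) x)]
  rfl

theorem partialDeriv_smul (h : IsTest Ω φ) (c : ℝ) (i : Fin 2) :
    partialDeriv i (c • φ) = c • partialDeriv i φ := by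
  funext x
  simp only [partialDeriv, Pi.smul_apply]
  rw [fderiv_const_smul (h.smooth.differentiable (by simp) x)]
  rfl

end IsTest

theorem inner_toLp (f : L2 Ω) {φ : E2 → ℝ} (hφ : MemLp φ 2 (volume.restrict Ω)) :
    ⟪hφ.toLp φ, f⟫_ℝ = ∫ x in Ω, f x * φ x := by
  rw [L2.inner_def]
  refine integral_congr_ae ?_
  filter_upwards [hφ.coeFn_toLp] with x hx
  rw [hx]
  rfl

theorem isWeakPartial_iff {i : Fin 2} {f g : L2 Ω} :
    IsWeakPartial Ω i f g ↔ ∀ φ (h : IsTest Ω φ),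
      ⟪(h.memLp_partialDeriv i).toLp _, f⟫_ℝ + ⟪h.memLp.toLp φ, g⟫_ℝ = 0 := by
  simp only [IsWeakPartial, inner_toLp, ← eq_neg_iff_add_eq_zero]

/-- Needed to identify the gradient approximated by test functions, from H¹₀, with the one whose
divergence is the Laplacian, from H². -/
theorem IsWeakPartial.unique (hΩ : IsOpen Ω) {i : Fin 2} {f g g' : L2 Ω}
    (h : IsWeakPartial Ω i f g) (h' : IsWeakPartial Ω i f g') : g = g' := by
  have hL : LocallyIntegrableOn (g - g' : L2 Ω) Ω volume := by
    rw [locallyIntegrableOn_iff hΩ.isLocallyClosed]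
    intro K hK hKc
    have h1 : MemLp (g - g' : L2 Ω) 2 (volume.restrict K) :=
      (Lp.memLp (g - g')).mono_measure (Measure.restrict_mono hK le_rfl)
    have : IsFiniteMeasure (volume.restrict K) := ⟨by simpa using hKc.measure_lt_top⟩
    exact h1.integrable (by norm_num)
  have hz := hΩ.ae_eq_zero_of_integral_contDiff_smul_eq_zero hL ?_
  · rw [← sub_eq_zero]
    apply Lp.ext
    have h0 := Lp.coeFn_zero (E := ℝ) (p := 2) (μ := volume.restrict Ω)
    have h1 := (ae_restrict_iff' (μ := volume) hΩ.measurableSet).2 hz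
    filter_upwards [h0, h1] with x hx0 hx1
    rw [hx0, hx1, Pi.zero_apply]
  · intro φ h1 h2 h3
    have ht : IsTest Ω φ := ⟨h1, h2, h3⟩
    have e1 := isWeakPartial_iff.1 h φ ht
    have e2 := isWeakPartial_iff.1 h' φ ht
    have e3 : ⟪ht.memLp.toLp φ, g - g'⟫_ℝ = 0 := by
      rw [inner_sub_right]
      linarith
    rw [inner_toLp] at e3
    rw [← e3, setIntegral_eq_integral_of_forall_compl_eq_zero]
    · simp only [smul_eq_mul, mul_comm]
    · intro x hx
      rw [show φ x = 0 by
        by_contra h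
        exact hx (h3 (subset_tsupport _ h)), mul_zero]

/-- The pairs `(φ, ∇φ)`, `φ ∈ C_c^∞(Ω)`. -/
def testGraph (Ω : Set E2) : Submodule ℝ (L2 Ω × (Fin 2 → L2 Ω)) where
  carrier := {p | ∃ φ, IsTest Ω φ ∧ p.1 =ᵐ[volume.restrict Ω] φ ∧
    ∀ i, p.2 i =ᵐ[volume.restrict Ω] partialDeriv i φ}
  zero_mem' := by
    refine ⟨0, IsTest.zero, Lp.coeFn_zero _ _ _, fun i => ?_⟩
    have h : partialDeriv i 0 = 0 := by
      funext x
      simp [partialDeriv]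
    rw [h]
    exact Lp.coeFn_zero _ _ _
  add_mem' := by
    rintro p q ⟨φ, hφ, h1, h2⟩ ⟨ψ, hψ, h3, h4⟩
    refine ⟨φ + ψ, hφ.add hψ, (Lp.coeFn_add _ _).trans (h1.add h3), fun i => ?_⟩
    rw [hφ.partialDeriv_add hψ]
    exact (Lp.coeFn_add _ _).trans ((h2 i).add (h4 i))
  smul_mem' := by
    rintro c p ⟨φ, hφ, h1, h2⟩
    refine ⟨c • φ, hφ.smul c, (Lp.coeFn_smul _ _).trans (h1.const_smul c), fun i => ?_⟩
    rw [hφ.partialDeriv_smul]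
    exact (Lp.coeFn_smul _ _).trans ((h2 i).const_smul c)

theorem edist_eq_eLpNorm_sub {f p : L2 Ω} {φ : E2 → ℝ} (h : p =ᵐ[volume.restrict Ω] φ) :
    edist f p = eLpNorm (fun x => f x - φ x) 2 (volume.restrict Ω) := by
  rw [Lp.edist_def]
  refine eLpNorm_congr_ae ?_
  filter_upwards [h] with x hx
  rw [Pi.sub_apply, hx]

/-- Expressed as membership in the closure of a linear subspace of pairs, the condition passes to
sums and limits. -/
theorem memH10_iff {f : L2 Ω} : MemH10 Ω f ↔ ∃ G : Fin 2 → L2 Ω,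
    (∀ i, IsWeakPartial Ω i f (G i)) ∧ (f, G) ∈ closure (testGraph Ω : Set _) := by
  simp only [MemH10, EMetric.mem_closure_iff]
  refine exists_congr fun G => and_congr_right fun _ => ⟨fun h ε hε => ?_, fun h ε hε => ?_⟩
  · obtain ⟨φ, hφ, h1, h2⟩ := h ε hε
    refine ⟨(hφ.memLp.toLp φ, fun i => (hφ.memLp_partialDeriv i).toLp _),
      ⟨φ, hφ, hφ.memLp.coeFn_toLp, fun i => (hφ.memLp_partialDeriv i).coeFn_toLp⟩, ?_⟩
    rw [Prod.edist_eq, max_lt_iff, edist_pi_def, Finset.sup_lt_iff hε]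
    refine ⟨?_, fun i _ => ?_⟩
    · rw [edist_eq_eLpNorm_sub hφ.memLp.coeFn_toLp]
      exact h1
    · rw [edist_eq_eLpNorm_sub (hφ.memLp_partialDeriv i).coeFn_toLp]
      exact h2 i
  · obtain ⟨p, ⟨φ, hφ, h1, h2⟩, hp⟩ := h ε hε
    rw [Prod.edist_eq, max_lt_iff, edist_pi_def, Finset.sup_lt_iff hε] at hp
    refine ⟨φ, hφ, ?_, fun i => ?_⟩
    · rw [← edist_eq_eLpNorm_sub h1]
      exact hp.1
    · rw [← edist_eq_eLpNorm_sub (h2 i)]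
      exact hp.2 i (Finset.mem_univ i)

/-- `H¹₀(Ω)` is stable under series which converge together with their gradients. -/
theorem memH10_of_hasSum {f : ℕ → L2 Ω} {G : ℕ → Fin 2 → L2 Ω} {a : L2 Ω} {Γ : Fin 2 → L2 Ω}
    (hw : ∀ k i, IsWeakPartial Ω i (f k) (G k i))
    (hc : ∀ k, (f k, G k) ∈ closure (testGraph Ω : Set _))
    (ha : HasSum f a) (hΓ : ∀ i, HasSum (fun k => G k i) (Γ i)) : MemH10 Ω a := by
  refine memH10_iff.2 ⟨Γ, fun i => isWeakPartial_iff.2 fun φ h => ?_, ?_⟩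
  · have h1 := ((innerSL ℝ ((h.memLp_partialDeriv i).toLp _)).hasSum ha).add
      ((innerSL ℝ (h.memLp.toLp φ)).hasSum (hΓ i))
    refine h1.unique ?_
    simp only [innerSL_apply_apply, isWeakPartial_iff.1 (hw _ i) φ h]
    exact hasSum_zero
  · have h1 : HasSum (fun k => (f k, G k)) (a, Γ) := ha.prodMk (Pi.hasSum.2 hΓ)
    rw [← Submodule.topologicalClosure_coe] at hc ⊢
    exact (testGraph Ω).isClosed_topologicalClosure.mem_of_tendsto h1
      (Eventually.of_forall fun s => Submodule.sum_mem _ fun k _ => hc k)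

/-- Green's formula. -/
theorem sum_inner_grad {g : L2 Ω} {G : Fin 2 → L2 Ω} {D : Fin 2 → Fin 2 → L2 Ω}
    (hD : ∀ i j, IsWeakPartial Ω j (G i) (D i j)) (hg : -g = ∑ i, D i i)
    {p : L2 Ω × (Fin 2 → L2 Ω)} (hp : p ∈ closure (testGraph Ω : Set _)) :
    ∑ i, ⟪p.2 i, G i⟫_ℝ = ⟪p.1, g⟫_ℝ := by
  have hcl : IsClosed {p : L2 Ω × (Fin 2 → L2 Ω) | ∑ i, ⟪p.2 i, G i⟫_ℝ = ⟪p.1, g⟫_ℝ} :=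
    isClosed_eq (by fun_prop) (by fun_prop)
  -- Both sides are continuous in the pair, and on test functions the identity is the definition of
  -- the weak derivatives of G.
  refine closure_minimal ?_ hcl hp
  rintro q ⟨φ, hφ, h1, h2⟩
  have e1 : q.1 = hφ.memLp.toLp φ := Lp.ext (h1.trans hφ.memLp.coeFn_toLp.symm)
  have e2 : ∀ i, q.2 i = (hφ.memLp_partialDeriv i).toLp _ := fun i =>
    Lp.ext ((h2 i).trans (hφ.memLp_partialDeriv i).coeFn_toLp.symm)
  have e3 : ⟪hφ.memLp.toLp φ, g⟫_ℝ = - ∑ i, ⟪hφ.memLp.toLp φ, D i i⟫_ℝ := by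
    rw [← inner_sum, ← hg, inner_neg_right, neg_neg]
  simp only [mem_ofPred_eq, e1, e2]
  rw [e3, ← Finset.sum_neg_distrib]
  exact Finset.sum_congr rfl fun i _ =>
    eq_neg_of_add_eq_zero_left (isWeakPartial_iff.1 (hD i i) φ hφ)

end Dirichlet

/-! ### Eigenfunction expansions and boundary values -/

namespace SpectralOperator

variable {H : Type*} [NormedAddCommGroup H] [InnerProductSpace ℝ H] [CompleteSpace H]
  (S : SpectralOperator H)

theorem exists_hasSum {c : ℕ → ℝ} (hc : S.Mem 0 c) : ∃ x, HasSum (fun k => c k • S.e k) x :=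
  ⟨_, S.e.hasSum_repr_symm ⟨c, by
    have := (S.mem_iff_memℓp 0 c).1 hc
    have h : S.pow 0 c = c := by
      funext k
      simp [pow]
    rwa [h] at this⟩⟩

/-- A self-adjoint operator is closed, and the partial sums lie in its graph. -/
theorem mem_graph_of_hasSum {c : ℕ → ℝ} {x y : H} (hx : HasSum (fun k => c k • S.e k) x)
    (hy : HasSum (fun k => (S.lam k * c k) • S.e k) y) : (x, y) ∈ S.A.graph := by
  have hcl : IsClosed (S.A.graph : Set (H × H)) := S.selfAdjoint.isClosed
  refine hcl.mem_of_tendsto (hx.prodMk hy) (Eventually.of_forall fun s =>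
    Submodule.sum_mem _ fun k _ => ?_)
  have h1 := S.A.graph.smul_mem (c k) (S.A.mem_graph ⟨S.e k, S.e_mem k⟩)
  rw [S.A_e] at h1
  simpa [smul_smul, mul_comm] using h1

end SpectralOperator

/-- By Green's formula ⟨∇e_k, ∇e_l⟩ = λ_l ⟨e_k, e_l⟩, so ∑ d_k ∇e_k is an orthogonal series with
squared norms λ_k d_k², summable exactly when d ∈ F_{1/2}. -/
theorem IsDirichletLaplacian.memH10_of_hasSum {Ω : Set E2} (hΩ : IsOpen Ω)
    {S : SpectralOperator (L2 Ω)} (hA : IsDirichletLaplacian Ω S.A) {d : ℕ → ℝ}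
    (hd : S.Mem (1 / 2) d) {a : L2 Ω} (ha : HasSum (fun k => d k • S.e k) a) : MemH10 Ω a := by
  have hgrad : ∀ k, ∃ G : Fin 2 → L2 Ω, (∀ i, IsWeakPartial Ω i (S.e k) (G i)) ∧
      (S.e k, G) ∈ closure (testGraph Ω : Set _) ∧
      ∀ p : L2 Ω × (Fin 2 → L2 Ω), p ∈ closure (testGraph Ω : Set _) →
        ∑ i, ⟪p.2 i, G i⟫_ℝ = ⟪p.1, S.lam k • S.e k⟫_ℝ := by
    intro k
    have h1 := S.A.mem_graph ⟨S.e k, S.e_mem k⟩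
    rw [S.A_e] at h1
    obtain ⟨h2, G', D, hG', hD, hs⟩ := (hA _ _).1 h1
    obtain ⟨G, hG, hcl⟩ := memH10_iff.1 h2
    have hGG : G = G' := funext fun i => (hG i).unique hΩ (hG' i)
    subst hGG
    exact ⟨G, hG, hcl, fun p hp => sum_inner_grad hD hs hp⟩
  choose G hGw hGc hGi using hgrad
  set γ : ℕ → PiLp 2 (fun _ : Fin 2 => L2 Ω) := fun k =>
    (Real.sqrt (S.lam k))⁻¹ • WithLp.toLp 2 (G k) with hγ
  have hsq : ∀ k, 0 < Real.sqrt (S.lam k) := fun k => Real.sqrt_pos.2 (S.lam_pos k)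
  have hort : Orthonormal ℝ γ := by
    rw [orthonormal_iff_ite]
    intro k l
    simp only [hγ]
    rw [real_inner_smul_left, real_inner_smul_right, PiLp.inner_apply]
    simp only
    rw [hGi l _ (hGc k), real_inner_smul_right, orthonormal_iff_ite.1 S.e.orthonormal k l]
    split_ifs with h
    · subst h
      have := hsq k
      field_simp
      rw [Real.sq_sqrt (S.lam_pos k).le]
    · simp
  have hsum : Summable fun k => (d k * Real.sqrt (S.lam k)) • γ k := by
    refine (hort.orthogonalFamily.summable_iff_norm_sq_summable
      fun k => d k * Real.sqrt (S.lam k)).2 ?_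
    have hd' : Summable fun k => S.lam k ^ (2 * (1 / 2 : ℝ)) * d k ^ 2 := hd
    refine hd'.congr fun k => ?_
    rw [Real.norm_eq_abs, sq_abs, mul_pow, Real.sq_sqrt (S.lam_pos k).le]
    norm_num
    ring
  obtain ⟨Γ, hΓ⟩ := hsum
  refine Berger.memH10_of_hasSum (f := fun k => d k • S.e k) (G := fun k => d k • G k)
    (Γ := fun i => Γ i) (fun k i => ?_) (fun k => ?_) ha (fun i => ?_)
  · refine isWeakPartial_iff.2 fun φ h => ?_
    have := isWeakPartial_iff.1 (hGw k i) φ h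
    rw [Pi.smul_apply, real_inner_smul_right, real_inner_smul_right, ← mul_add, this, mul_zero]
  · have := (testGraph Ω).topologicalClosure.smul_mem (d k) (hGc k)
    exact this
  · have h1 := (PiLp.proj (𝕜 := ℝ) 2 (fun _ : Fin 2 => L2 Ω) i).hasSum hΓ
    refine h1.congr_fun fun k => ?_
    have h2 : (d k * Real.sqrt (S.lam k)) • γ k = d k • WithLp.toLp 2 (G k) := by
      simp only [hγ]
      rw [smul_smul, mul_assoc, mul_inv_cancel₀ (hsq k).ne', mul_one]
    rw [h2]
    rfl

/-- Series in `F_{3/2}` have a Laplacian in `H¹₀(Ω)`. -/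
theorem IsDirichletLaplacian.exists_laplacian {Ω : Set E2} (hΩ : IsOpen Ω)
    {S : SpectralOperator (L2 Ω)} (hA : IsDirichletLaplacian Ω S.A) {s : ℝ} (x : S.F s)
    (hx : S.Mem (3 / 2) x.coeff) : ∃ g, HasLaplacian Ω (S.toH x) g ∧ MemH10 Ω g := by
  set z : S.F (3 / 2) := SpectralOperator.ofMem hx
  obtain ⟨y, hy⟩ := S.exists_hasSum (S.mem_pow (r := 0) (t := 0) (by norm_num) z)
  -- The minus sign makes a = -A x, which is the Laplacian itself.
  have hd := S.mem_pow (r := 1) (t := 1 / 2) (by norm_num) (-z)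
  obtain ⟨a, ha⟩ := S.exists_hasSum (S.mem_pow (r := 1) (t := 0) (by norm_num) (-z))
  have hxs : HasSum (fun k => x.coeff k • S.e k) y := by
    refine hy.congr_fun fun k => ?_
    simp [SpectralOperator.pow, z]
  have hpow : ∀ k, S.pow 1 (-z).coeff k = -(S.lam k * x.coeff k) := fun k => by
    rw [SpectralOperator.pow, SpectralOperator.F.coeff_neg, SpectralOperator.coeff_ofMem,
      Real.rpow_one, Pi.neg_apply, mul_neg]
  have hya : (y, -a) ∈ S.A.graph := by
    refine S.mem_graph_of_hasSum hxs (ha.neg.congr_fun fun k => ?_)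
    rw [hpow, neg_smul, neg_neg]
  have hyx : S.toH x = y := hxs.tsum_eq
  refine ⟨a, ?_, hA.memH10_of_hasSum hΩ hd ha⟩
  have := ((hA _ _).1 hya).2
  rwa [neg_neg, ← hyx] at this

end Berger

theorem proposition2p2 :
    (∀ (H : Type*) [NormedAddCommGroup H] [InnerProductSpace ℝ H] [CompleteSpace H]
      (S : Berger.SpectralOperator H) (P : Berger.PlateData S)
      (U₀ : P.Phase) (U : ℝ → P.Phase),
      P.InDomain U₀ → P.BoundedPastHistory U₀ → P.IsClassicalSolution U₀ U →
        P.DisplacementContinuous U) ∧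
    (∀ (Ω : Set Berger.E2), IsOpen Ω → IsConnected Ω → Bornology.IsBounded Ω →
      ∀ (S : Berger.SpectralOperator (Berger.L2 Ω)), Berger.IsDirichletLaplacian Ω S.A →
      ∀ (P : Berger.PlateData S) (U₀ : P.Phase) (U : ℝ → P.Phase),
      P.InDomain U₀ → P.BoundedPastHistory U₀ → P.IsClassicalSolution U₀ U →
        ∀ t : ℝ, 0 ≤ t → ∃ g : Berger.L2 Ω,
          Berger.HasLaplacian Ω (S.toH (Berger.PlateData.u (U t))) g ∧ Berger.MemH10 Ω g) := by
  refine ⟨fun H _ _ _ S P U₀ U _ hP hU => Berger.PlateData.displacementContinuous hP hU,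
    fun Ω hΩ _ _ S hA P U₀ U _ hP hU t ht => ?_⟩
  obtain ⟨g, -, hg⟩ := Berger.PlateData.exists_lift hP hU
  exact hA.exists_laplacian hΩ _ (hg t ht ▸ (g t).mem)
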